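/- Let $n\ge 0$. A standard word of length $n$ is a rearrangement $w=w_1\cdots w_n$ of $1,\dots,n$. Its cocharge labeling $\mathrm{cl}(w)=z_1\cdots z_n$ is obtained by labeling the number $1$ of $w$ with $0$ and, if the number $i$ has label $k$, labeling $i+1$ with $k$ if $i+1$ stands to the right of $i$ in $w$ and with $k+1$ if it stands to the left; $z_j$ is the label of $w_j$. Let $ws_i$ (resp. $zs_i$) be the word obtained by exchanging the entries in positions $i$ and $i+1$. For standard words $u,v$ of length $n$, $u\rightsquigarrow v$ is an ascent if for some $1\le i\le n-1$ one has $v=us_i$, $\mathrm{cl}(us_i)=\mathrm{cl}(u)s_i$ (the exchange is cocharge-preserving), and $z_i>z_{i+1}$, where $z=\mathrm{cl}(u)$. Let $P(w)$ denote the Robinson–Schensted (row) insertion tableau of a word $w$, in English notation, and let the row reading word of a tableau list its rows from bottom to top, each from left to right. If the first row of a tableau $T$ has at least $m$ entries, let $\mathrm{Cat}_m(T)=P(xy)$, where $x$ is the first row of $T$ without its first $m$ entries and $y$ is the row reading word of the part of $T$ below the first row. The empty tableau is $\varnothing$-catabolizable, and for a partition $\lambda=(\lambda_1,\lambda_2,\dots)$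 of the number of entries of $T$, $T$ is $\lambda$-catabolizable if its first row has at least $\lambda_1$ entries, the first $\lambda_1$ of these are the $\lambda_1$ smallest entries of $T$, and $\mathrm{Cat}_{\lambda_1}(T)$ is $(\lambda_2,\lambda_3,\dots)$-catabolizable. For a standard word $w$ of length $n$, let $\mathrm{ctype}(w)$ be the greatest partition $\lambda$ of $n$ in dominance order (equivalently, as there are finitely many, the unique maximal one) such that $P(w)$ is $\lambda$-catabolizable. If $u\rightsquigarrow v$ is an ascent, then $\mathrm{ctype}(u)$ and $\mathrm{ctype}(v)$ exist, and $\mathrm{ctype}(u)\trianglerighteq\mathrm{ctype}(v)$ in dominance order, i.e. $\sum_{i\le k}\mathrm{ctype}(u)_i\ge\sum_{i\le k}\mathrm{ctype}(v)_i$ for all $k$. -/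

import Mathlib

namespace Catabolism

/-! ### Standard words, cocharge labelings, ascents -/

/-- A standard word of length `n`: a rearrangement of the numbers `1, …, n`. -/
structure StandardWord (n : ℕ) where
  letters : List ℕ
  perm : letters.Perm (List.range' 1 n)

/-- The cocharge label of the number `i` of the word `w`: the number `1` has label `0`, and
`i + 1` has the label of `i`, increased by one if `i + 1` stands to the left of `i` in `w`.
(The value at `0`, which is not a letter of a standard word, is irrelevant.) -/
def cochargeLabel (w : List ℕ) : ℕ → ℕ
  | 0 => 0
  | 1 => 0
  | i + 2 =>
    if w.idxOf (i + 2) < w.idxOf (i + 1) then cochargeLabel w (i + 1) + 1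
    else cochargeLabel w (i + 1)

/-- The cocharge labeling of `w`: each number of `w` is replaced by its label. -/
def cochargeLabeling (w : List ℕ) : List ℕ := w.map (cochargeLabel w)

/-- The right action of a simple reflection on words: exchange the entries at the adjacent
positions `i` and `i + 1` (positions are counted from `0`). -/
def swapAdjacent : ℕ → List ℕ → List ℕ
  | 0, a :: b :: l => b :: a :: l
  | i + 1, a :: l => a :: swapAdjacent i l
  | _, l => l

/-- Exchanging the entries of `w` at positions `i`, `i + 1` is cocharge-preserving: the cocharge
labeling of the new word arises from that of `w` by the same exchange. -/
def IsCochargePreserving (w : List ℕ) (i : ℕ) : Prop :=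
  cochargeLabeling (swapAdjacent i w) = swapAdjacent i (cochargeLabeling w)

/-- `u ⇝ v` is an ascent: `v` arises from `u` by a cocharge-preserving exchange of two adjacent
entries, the left one of which has the larger cocharge label in `u`. -/
def IsAscent {n : ℕ} (u v : StandardWord n) : Prop :=
  ∃ i : ℕ, i + 1 < n ∧ v.letters = swapAdjacent i u.letters ∧
    IsCochargePreserving u.letters i ∧
    (cochargeLabeling u.letters).getD i 0 > (cochargeLabeling u.letters).getD (i + 1) 0

/-! ### Tableaux and insertion

A tableau is given by the list of its rows, from the top row down (English notation). -/

/-- Row insertion of `x` into a row: `x` replaces the leftmost entry larger than `x`, which is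
bumped (returned in the second component), or is appended if there is none. -/
def insertRow (x : ℕ) : List ℕ → List ℕ × Option ℕ
  | [] => ([x], none)
  | y :: r => if x < y then (x :: r, some y) else (y :: (insertRow x r).1, (insertRow x r).2)

/-- Row insertion of `x` into a tableau. -/
def insertTableau (x : ℕ) : List (List ℕ) → List (List ℕ)
  | [] => [[x]]
  | r :: T =>
    match insertRow x r with
    | (r', none) => r' :: T
    | (r', some y) => r' :: insertTableau y T

/-- The (Robinson–Schensted) insertion tableau `P(w)` of the word `w`. -/
def insertionTableau (w : List ℕ) : List (List ℕ) :=
  w.foldl (fun T x => insertTableau x T) []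

/-- The row reading word: the rows from bottom to top, each from left to right. -/
def rowWord (T : List (List ℕ)) : List ℕ := T.reverse.flatten

/-- The first row of a tableau (empty for the empty tableau). -/
def firstRow (T : List (List ℕ)) : List ℕ := T.headD []

/-! ### Catabolism -/

/-- The `m`-catabolism of `T`: delete the first `m` entries of the first row, cut the rest between
the first and the second row into a north part and a south part, and insert the word of the north
part followed by the row reading word of the south part. -/
def catabolism (m : ℕ) (T : List (List ℕ)) : List (List ℕ) :=
  insertionTableau ((firstRow T).drop m ++ rowWord T.tail)

/-- `T` is `λ`-catabolizable, for a list `λ = (λ₁, λ₂, …)`: the first row of `T` has at least `λ₁`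
entries, its first `λ₁` entries are the `λ₁` smallest entries of `T`, and the `λ₁`-catabolism
of `T` is `(λ₂, λ₃, …)`-catabolizable; for the empty list, `T` is empty. -/
def IsCatabolizable : List ℕ → List (List ℕ) → Prop
  | [], T => T = []
  | m :: l, T =>
    m ≤ (firstRow T).length ∧
    (∀ x ∈ (firstRow T).take m, ∀ y ∈ (firstRow T).drop m ++ rowWord T.tail, x < y) ∧
    IsCatabolizable l (catabolism m T)

/-- The parts of a partition in weakly decreasing order. -/
def partsList {n : ℕ} (p : n.Partition) : List ℕ := p.parts.sort (· ≥ ·)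

/-- Dominance order: `p` dominates `q` if, for every `k`, the sum of the `k` largest parts
of `p` is at least that of `q`. -/
def Dominates {n : ℕ} (p q : n.Partition) : Prop :=
  ∀ k : ℕ, ((partsList q).take k).sum ≤ ((partsList p).take k).sum

/-- `p` is the greatest element, in dominance order, among the partitions `q` of `n` for
which `T` is `q`-catabolizable. (As there are finitely many partitions of `n`, this is the
same as being the unique maximal element.) -/
def IsCatabolizability {n : ℕ} (T : List (List ℕ)) (p : n.Partition) : Prop :=
  IsCatabolizable (partsList p) T ∧
    ∀ q : n.Partition, IsCatabolizable (partsList q) T → Dominates p q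

/-- The catabolizability of the standard word `w`, i.e. of its insertion tableau: the partition
`p` with `IsCatabolizability (insertionTableau w.letters) p`. -/
noncomputable def ctype {n : ℕ} (w : StandardWord n) : n.Partition :=
  Classical.epsilon fun p : n.Partition => IsCatabolizability (insertionTableau w.letters) p

end Catabolism

namespace Catabolism

/-! ### The insertion procedure for catabolizability -/

/-! The catabolizability can be read off from the cocharge word by a token procedure. Put `M` tokens
in row 0 and read the labels cyclically from right to left: a letter `a` is accepted if row `a` has
a token, which climbs to row `a + 1`; otherwise it becomes `a + 1`. Since tokens climb one row at a
time, `M` minus the number of tokens in rows `0, …, i` counts the letters accepted in row `i`. For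
`M = n` the numbers `accepted k n` turn out to be the partial sums of `ctype`.

The outcome is invariant under label moves (`LabelMove.pass_equiv`), and Knuth moves of the letters
induce such moves of the labels, so the word may be replaced by the row word `y a x` of its tableau.
If `a` is a block of `m` zero labels and there are `m` tokens, row 0 accepts `m` letters and the
rest is the same procedure, one row higher, on the catabolized word `x y` (`accepted_succ`). As
`accepted` grows with the number of tokens, it bounds every catabolizable partition
(`IsLabeled.sum_take_le`); cutting off as many zeros as allowed attains the bound
(`IsLabeled.exists_isCatabolizable`).

An ascent moves a larger label to the right past a smaller one. Once voluntary rejections are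
admitted, every run on the labels of `v` can be imitated on those of `u` (`PassRel.raised`), and no
run beats the greedy one (`IsRun.sum_rowLoad_le`). Hence `accepted` can only drop along an ascent.
-/

/-- Move a token from row `a` to row `a + 1`. -/
def raise (a : ℕ) (g : ℕ → ℕ) : ℕ → ℕ :=
  fun j => if j = a then g j - 1 else if j = a + 1 then g j + 1 else g j

/-- Read a word of labels from right to left. A letter `a` is accepted (and vanishes) if row `a`
has a token, which then moves to row `a + 1`; otherwise the letter is increased by one. -/
def pass : List ℕ → (ℕ → ℕ) → List ℕ × (ℕ → ℕ)
  | [], g => ([], g)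
  | a :: z, g =>
    if 0 < (pass z g).2 a then ((pass z g).1, raise a (pass z g).2)
    else ((a + 1) :: (pass z g).1, (pass z g).2)

/-- Iterated passes. -/
def passes : ℕ → List ℕ → (ℕ → ℕ) → List ℕ × (ℕ → ℕ)
  | 0, z, g => (z, g)
  | K + 1, z, g => passes K (pass z g).1 (pass z g).2

theorem pass_append (u v : List ℕ) (g : ℕ → ℕ) :
    pass (u ++ v) g =
      ((pass u (pass v g).2).1 ++ (pass v g).1, (pass u (pass v g).2).2) := by
  induction u with
  | nil => simp [pass]
  | cons a u ih =>
    simp only [List.cons_append, pass, ih]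
    split_ifs <;> simp

theorem passes_succ' (K : ℕ) (z : List ℕ) (g : ℕ → ℕ) :
    passes (K + 1) z g = pass (passes K z g).1 (passes K z g).2 := by
  induction K generalizing z g with
  | zero => rfl
  | succ K ih => rw [passes, ih]; rfl

theorem le_of_mem_pass {r : ℕ} {z : List ℕ} (g : ℕ → ℕ) (h : ∀ x ∈ z, r ≤ x) :
    ∀ x ∈ (pass z g).1, r + 1 ≤ x := by
  induction z with
  | nil => simp [pass]
  | cons a z ih =>
    have ih' := ih fun x hx => h x (by simp [hx])
    have ha := h a (by simp)
    simp only [pass]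
    split_ifs
    · exact ih'
    · simp only [List.mem_cons, forall_eq_or_imp]
      exact ⟨by omega, ih'⟩

theorem pass_apply_of_lt {r : ℕ} {z : List ℕ} (g : ℕ → ℕ) (h : ∀ x ∈ z, r ≤ x) {j : ℕ}
    (hj : j < r) : (pass z g).2 j = g j := by
  induction z with
  | nil => simp [pass]
  | cons a z ih =>
    have ih' := ih fun x hx => h x (by simp [hx])
    have ha := h a (by simp)
    simp only [pass]
    split_ifs
    · simp only [raise]
      rw [if_neg (by omega), if_neg (by omega), ih']
    · exact ih'

theorem le_of_mem_passes {r : ℕ} {z : List ℕ} (g : ℕ → ℕ) (h : ∀ x ∈ z, r ≤ x) (K : ℕ) :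
    ∀ x ∈ (passes K z g).1, r + K ≤ x := by
  induction K with
  | zero => simpa [passes] using h
  | succ K ih => rw [passes_succ']; exact le_of_mem_pass _ ih

/-- After `K` passes every surviving letter is at least `K`, so the rows below `K` are settled. -/
theorem passes_succ_apply (K : ℕ) (z : List ℕ) (g : ℕ → ℕ) {j : ℕ} (hj : j < K) :
    (passes (K + 1) z g).2 j = (passes K z g).2 j := by
  rw [passes_succ']
  refine pass_apply_of_lt _ (r := K) (fun x hx => ?_) hj
  simpa using le_of_mem_passes (r := 0) g (fun _ _ => Nat.zero_le _) K x hx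

/-- Reading is cyclic. The left run is ahead by one reading of what remains of `v` after `K` passes;
those letters are at least `r + K` and do not touch the rows below. -/
theorem passes_rotate {r : ℕ} (u v : List ℕ) (g : ℕ → ℕ) (h : ∀ x ∈ u ++ v, r ≤ x) (K j : ℕ)
    (hj : j < r + K) :
    (passes K ((pass v g).1 ++ u) (pass v g).2).2 j = (passes K (u ++ v) g).2 j := by
  induction K generalizing r u v g with
  | zero =>
    exact pass_apply_of_lt g (fun x hx => h x (by simp [hx])) (by simpa using hj)
  | succ K ih =>
    simp only [passes, pass_append]
    refine ih (r := r + 1) _ _ _ (fun x hx => ?_) (by omega)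
    rcases List.mem_append.1 hx with hx | hx
    · exact le_of_mem_pass _ (fun x hx => h x (by simp [hx])) x hx
    · exact le_of_mem_pass _ (fun x hx => h x (by simp [hx])) x hx

/-! ### Moves which do not change the outcome -/

/-- The elementary exchanges of a word of labels under which the procedure is invariant. -/
inductive LabelMove : List ℕ → List ℕ → Prop
  | far {a c : ℕ} (h : a + 2 ≤ c) : LabelMove [a, c] [c, a]
  | high (a : ℕ) : LabelMove [a + 1, a + 1, a] [a + 1, a, a + 1]
  | low (a : ℕ) : LabelMove [a, a + 1, a] [a + 1, a, a]

/-- The congruence generated by the label moves. -/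
inductive LabelEquiv : List ℕ → List ℕ → Prop
  | refl (z : List ℕ) : LabelEquiv z z
  | symm {z z' : List ℕ} : LabelEquiv z z' → LabelEquiv z' z
  | trans {z z' z'' : List ℕ} : LabelEquiv z z' → LabelEquiv z' z'' → LabelEquiv z z''
  | move (p q : List ℕ) {m m' : List ℕ} : LabelMove m m' → LabelEquiv (p ++ m ++ q) (p ++ m' ++ q)

theorem LabelEquiv.append {z z' : List ℕ} (h : LabelEquiv z z') (p q : List ℕ) :
    LabelEquiv (p ++ z ++ q) (p ++ z' ++ q) := by
  induction h with
  | refl z => exact .refl _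
  | symm _ ih => exact ih.symm
  | trans _ _ ih ih' => exact ih.trans ih'
  | move p' q' hm => simpa using LabelEquiv.move (p ++ p') (q' ++ q) hm

theorem LabelMove.equiv {m m' : List ℕ} (h : LabelMove m m') : LabelEquiv m m' := by
  simpa using LabelEquiv.move [] [] h

theorem raise_comm {a c : ℕ} (h : a + 2 ≤ c) (g : ℕ → ℕ) :
    raise a (raise c g) = raise c (raise a g) := by
  funext j
  simp only [raise]
  split_ifs <;> omega

theorem raise_self (a : ℕ) (g : ℕ → ℕ) : raise a g a = g a - 1 := by simp [raise]

theorem raise_succ (a : ℕ) (g : ℕ → ℕ) : raise a g (a + 1) = g (a + 1) + 1 := by simp [raise]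

theorem raise_succ_self (a : ℕ) (g : ℕ → ℕ) : raise (a + 1) g a = g a := by
  simp only [raise]; split_ifs <;> omega

theorem pass_cons_of_pos {a : ℕ} {z z' : List ℕ} {g g' : ℕ → ℕ} (h : pass z g = (z', g'))
    (ha : 0 < g' a) : pass (a :: z) g = (z', raise a g') := by
  simp [pass, h, ha]

theorem pass_cons_of_eq_zero {a : ℕ} {z z' : List ℕ} {g g' : ℕ → ℕ} (h : pass z g = (z', g'))
    (ha : g' a = 0) : pass (a :: z) g = ((a + 1) :: z', g') := by
  simp [pass, h, ha]

/-- If all letters are rejected, the same move remains with labels one higher; in every other case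
the remaining words coincide. -/
theorem LabelMove.pass_equiv {m m' : List ℕ} (h : LabelMove m m') (g : ℕ → ℕ) :
    LabelEquiv (pass m g).1 (pass m' g).1 ∧ (pass m g).2 = (pass m' g).2 := by
  cases h with
  | @far a c h =>
    have h1 : raise c g a = g a := by simp only [raise]; split_ifs <;> omega
    have h2 : raise a g c = g c := by simp only [raise]; split_ifs <;> omega
    by_cases ha : 0 < g a <;> by_cases hc : 0 < g c <;>
      simp [pass, ha, hc, h1, h2, raise_comm h, LabelEquiv.refl]
    exact (LabelMove.far (by omega)).equiv
  | high a =>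
    -- With one letter `a` and two letters `a + 1`, it only matters whether row `a` is empty and
    -- whether row `a + 1` has 0, 1 or at least 2 tokens.
    have h1 : g a = 0 ∨ g a = (g a - 1) + 1 := by omega
    have h2 : g (a + 1) = 0 ∨ g (a + 1) = 1 ∨ g (a + 1) = (g (a + 1) - 2) + 2 := by omega
    generalize g a - 1 = r at h1
    generalize g (a + 1) - 2 = s at h2
    rcases h1 with ha | ha <;> rcases h2 with hb | hb | hb
    all_goals simp [pass, raise_self, raise_succ, raise_succ_self, ha, hb, LabelEquiv.refl]
    · exact (LabelMove.high (a + 1)).equiv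
    all_goals
      funext j
      have e1 : j = a → g j = g a := fun h => by rw [h]
      have e2 : j = a + 1 → g j = g (a + 1) := fun h => by rw [h]
      simp only [raise]
      split_ifs <;> omega
  | low a =>
    have h1 : g a = 0 ∨ g a = 1 ∨ g a = (g a - 2) + 2 := by omega
    have h2 : g (a + 1) = 0 ∨ g (a + 1) = (g (a + 1) - 1) + 1 := by omega
    generalize g a - 2 = r at h1
    generalize g (a + 1) - 1 = s at h2
    rcases h1 with ha | ha | ha <;> rcases h2 with hb | hb
    all_goals simp [pass, raise_self, raise_succ, raise_succ_self, ha, hb, LabelEquiv.refl]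
    · exact (LabelMove.low (a + 1)).equiv
    all_goals
      funext j
      have e1 : j = a → g j = g a := fun h => by rw [h]
      have e2 : j = a + 1 → g j = g (a + 1) := fun h => by rw [h]
      simp only [raise]
      split_ifs <;> omega

theorem LabelEquiv.pass_equiv {z z' : List ℕ} (h : LabelEquiv z z') (g : ℕ → ℕ) :
    LabelEquiv (pass z g).1 (pass z' g).1 ∧ (pass z g).2 = (pass z' g).2 := by
  induction h with
  | refl z => exact ⟨.refl _, rfl⟩
  | symm _ ih => exact ⟨ih.1.symm, ih.2.symm⟩
  | trans _ _ ih ih' => exact ⟨ih.1.trans ih'.1, ih.2.trans ih'.2⟩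
  | move p q hm =>
    have := hm.pass_equiv (pass q g).2
    simp only [pass_append, this.2]
    exact ⟨this.1.append _ _, trivial⟩

theorem LabelEquiv.passes_snd {z z' : List ℕ} (h : LabelEquiv z z') (g : ℕ → ℕ) (K : ℕ) :
    (passes K z g).2 = (passes K z' g).2 := by
  induction K generalizing z z' g with
  | zero => rfl
  | succ K ih =>
    have := h.pass_equiv g
    simp only [passes, this.2]
    exact ih this.1 _

/-! ### The number of letters accepted by the first rows -/

/-- The initial state: `M` tokens in row `0`. -/
def tokens (M : ℕ) : ℕ → ℕ := fun j => if j = 0 then M else 0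

/-- The number of letters accepted by the rows `0, …, k - 1` in the state `g`, if the procedure
started with `M` tokens. -/
def acceptedSum (k M : ℕ) (g : ℕ → ℕ) : ℤ :=
  ∑ i ∈ Finset.range k, ((M : ℤ) - ∑ j ∈ Finset.range (i + 1), (g j : ℤ))

/-- The number of letters of `z` finally accepted by the rows `0, …, k - 1`. -/
def accepted (k M : ℕ) (z : List ℕ) : ℤ := acceptedSum k M (passes k z (tokens M)).2

theorem acceptedSum_congr {k M : ℕ} {g g' : ℕ → ℕ} (h : ∀ j < k, g j = g' j) :
    acceptedSum k M g = acceptedSum k M g' := by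
  refine Finset.sum_congr rfl fun i hi => ?_
  congr 1
  refine Finset.sum_congr rfl fun j hj => ?_
  rw [Finset.mem_range] at hi hj
  rw [h j (by omega)]

theorem LabelEquiv.accepted_eq {z z' : List ℕ} (h : LabelEquiv z z') (k M : ℕ) :
    accepted k M z = accepted k M z' := by
  rw [accepted, accepted, h.passes_snd]

/-- Shift the state by one row. -/
def shift (g : ℕ → ℕ) : ℕ → ℕ
  | 0 => 0
  | k + 1 => g k

/-! ### Shifting by one row, and the effect of a catabolism -/

theorem raise_shift (a : ℕ) (g : ℕ → ℕ) : raise (a + 1) (shift g) = shift (raise a g) := by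
  funext j
  cases j <;> simp [raise, shift]

theorem pass_shift (z : List ℕ) (g : ℕ → ℕ) :
    pass (z.map (· + 1)) (shift g) = ((pass z g).1.map (· + 1), shift (pass z g).2) := by
  induction z with
  | nil => rfl
  | cons a z ih =>
    simp only [List.map_cons, pass, ih]
    by_cases h : 0 < (pass z g).2 a <;> simp [shift, h, raise_shift]

theorem passes_shift (K : ℕ) (z : List ℕ) (g : ℕ → ℕ) :
    (passes K (z.map (· + 1)) (shift g)).2 = shift (passes K z g).2 := by
  induction K generalizing z g with
  | zero => rfl
  | succ K ih => simp only [passes, pass_shift, ih]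

theorem acceptedSum_shift (k M : ℕ) (g : ℕ → ℕ) :
    acceptedSum (k + 1) M (shift g) = M + acceptedSum k M g := by
  have h : ∀ i, (M : ℤ) - ∑ j ∈ Finset.range (i + 1 + 1), (shift g j : ℤ) =
      M - ∑ j ∈ Finset.range (i + 1), (g j : ℤ) := fun i => by
    rw [Finset.sum_range_succ']
    simp [shift]
  rw [acceptedSum, Finset.sum_range_succ', Finset.sum_congr rfl fun i _ => h i, acceptedSum]
  simp [shift, add_comm]

theorem pass_eq_of_rejected {z : List ℕ} {g : ℕ → ℕ} (h : ∀ x ∈ z, g x = 0) :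
    pass z g = (z.map (· + 1), g) := by
  induction z with
  | nil => rfl
  | cons a z ih =>
    exact pass_cons_of_eq_zero (ih fun x hx => h x (by simp [hx])) (h a (by simp))

theorem pass_replicate_zero (m : ℕ) : pass (List.replicate m 0) (tokens m) =
    ([], shift (tokens m)) := by
  have key : ∀ d e : ℕ, pass (List.replicate d 0) (tokens (d + e)) =
      ([], fun j => if j = 0 then e else if j = 1 then d else 0) := by
    intro d
    induction d with
    | zero =>
      intro e
      simp only [List.replicate_zero, pass, Prod.mk.injEq, true_and]
      funext j
      simp only [tokens]
      split_ifs <;> omega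
    | succ d ih =>
      intro e
      rw [List.replicate_succ, show d + 1 + e = d + (e + 1) by omega,
        pass_cons_of_pos (ih (e + 1)) (by simp)]
      simp only [Prod.mk.injEq, true_and]
      funext j
      simp only [raise]
      split_ifs <;> omega
  have := key m 0
  rw [Nat.add_zero] at this
  rw [this]
  simp only [Prod.mk.injEq, true_and]
  funext j
  rcases j with _ | _ | j <;> simp [shift, tokens]

/-- In the first pass `x` meets no token outside row 0, and exactly `m` zeros use up the tokens.
What is left of the right part is `x` raised by one, with all tokens in row 1; rotating it in front
of the raised `y` gives the procedure for `x ++ y` one row higher. -/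
theorem accepted_succ (k m : ℕ) {y x : List ℕ} (hx : x.Pairwise (· ≤ ·)) :
    accepted (k + 1) m (y.map (· + 1) ++ List.replicate m 0 ++ x) = m + accepted k m (x ++ y) := by
  obtain ⟨d, x', rfl, hx'⟩ : ∃ d x', x = List.replicate d 0 ++ x' ∧ ∀ a ∈ x', 0 < a := by
    induction x with
    | nil => exact ⟨0, [], by simp⟩
    | cons a x ih =>
      rw [List.pairwise_cons] at hx
      rcases Nat.eq_zero_or_pos a with rfl | ha
      · obtain ⟨d, x', rfl, h⟩ := ih hx.2
        exact ⟨d + 1, x', rfl, h⟩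
      · refine ⟨0, a :: x, rfl, fun b hb => ?_⟩
        rcases List.mem_cons.1 hb with rfl | hb
        · exact ha
        · exact ha.trans_le (hx.1 b hb)
  -- The zeros are interchangeable; the `m` rightmost ones, read first, are those accepted.
  have hr : List.replicate m 0 ++ (List.replicate d 0 ++ x') =
      List.replicate d 0 ++ (List.replicate m 0 ++ x') := by
    rw [← List.append_assoc, ← List.append_assoc, List.replicate_append_replicate,
      List.replicate_append_replicate, add_comm]
  have hp : pass (List.replicate d 0 ++ (List.replicate m 0 ++ x')) (tokens m) =
      ((List.replicate d 0 ++ x').map (· + 1), shift (tokens m)) := by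
    rw [pass_append, pass_append, pass_eq_of_rejected (z := x')]
    · simp only [pass_replicate_zero]
      rw [pass_eq_of_rejected]
      · simp
      · intro a ha
        rw [List.eq_of_mem_replicate ha]
        rfl
    · intro a ha
      simp [tokens, (hx' a ha).ne']
  rw [accepted, List.append_assoc, hr]
  have hrot : ∀ j < k + 1, (passes (k + 1) (y.map (· + 1) ++
      (List.replicate d 0 ++ (List.replicate m 0 ++ x'))) (tokens m)).2 j =
      shift (passes (k + 1) ((List.replicate d 0 ++ x') ++ y) (tokens m)).2 j := by
    intro j hj
    rw [← passes_rotate (r := 0) _ _ _ (fun _ _ => Nat.zero_le _) _ _ (by omega), hp,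
      ← List.map_append, passes_shift]
  rw [acceptedSum_congr hrot, acceptedSum_shift, accepted]
  congr 1
  exact acceptedSum_congr fun j hj => passes_succ_apply k _ _ hj

/-! ### Runs with voluntary rejections -/

/-- A pass in which any letter `a` may be rejected in a state `g` with `P g a`. -/
inductive PassRel (P : (ℕ → ℕ) → ℕ → Prop) : List ℕ → (ℕ → ℕ) → List ℕ → (ℕ → ℕ) → Prop
  | nil (g : ℕ → ℕ) : PassRel P [] g [] g
  | accept {a : ℕ} {z z' : List ℕ} {g g' : ℕ → ℕ} :
      PassRel P z g z' g' → 0 < g' a → PassRel P (a :: z) g z' (raise a g')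
  | reject {a : ℕ} {z z' : List ℕ} {g g' : ℕ → ℕ} :
      PassRel P z g z' g' → P g' a → PassRel P (a :: z) g ((a + 1) :: z') g'

/-- Iterated passes with rejections governed by `P`. -/
inductive PassesRel (P : (ℕ → ℕ) → ℕ → Prop) : ℕ → List ℕ → (ℕ → ℕ) → (ℕ → ℕ) → Prop
  | zero (z : List ℕ) (g : ℕ → ℕ) : PassesRel P 0 z g g
  | succ {K : ℕ} {z z' : List ℕ} {g g' g'' : ℕ → ℕ} :
      PassRel P z g z' g' → PassesRel P K z' g' g'' → PassesRel P (K + 1) z g g''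

/-- Rejection of a letter only if its row has no token. -/
def Greedy (g : ℕ → ℕ) (a : ℕ) : Prop := g a = 0

/-- Voluntary rejections. -/
def Free (_ : ℕ → ℕ) (_ : ℕ) : Prop := True

theorem passRel_pass {P : (ℕ → ℕ) → ℕ → Prop} (hP : ∀ g a, g a = 0 → P g a) (z : List ℕ)
    (g : ℕ → ℕ) : PassRel P z g (pass z g).1 (pass z g).2 := by
  induction z with
  | nil => exact .nil g
  | cons a z ih =>
    simp only [pass]
    split_ifs with h
    · exact ih.accept h
    · exact ih.reject (hP _ _ (by omega))

theorem passesRel_passes {P : (ℕ → ℕ) → ℕ → Prop} (hP : ∀ g a, g a = 0 → P g a) (K : ℕ)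
    (z : List ℕ) (g : ℕ → ℕ) : PassesRel P K z g (passes K z g).2 := by
  induction K generalizing z g with
  | zero => exact .zero z g
  | succ K ih => exact .succ (passRel_pass hP z g) (ih _ _)

/-- Add `r` tokens in row `0`. -/
def bump (r : ℕ) (g : ℕ → ℕ) : ℕ → ℕ := fun j => if j = 0 then g j + r else g j

theorem bump_tokens (r m : ℕ) : bump r (tokens m) = tokens (m + r) := by
  funext j
  simp only [bump, tokens]
  split_ifs <;> rfl

theorem raise_bump {r a : ℕ} {g : ℕ → ℕ} (h : 0 < g a) :
    raise a (bump r g) = bump r (raise a g) := by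
  funext j
  have : j = a → g j = g a := fun h => by rw [h]
  simp only [raise, bump]
  split_ifs <;> omega

/-- The same decisions stay legal with extra tokens, though they need no longer be greedy; hence
`Free`. -/
theorem PassRel.bump {z z' : List ℕ} {g g' : ℕ → ℕ} (h : PassRel Free z g z' g') (r : ℕ) :
    PassRel Free z (bump r g) z' (bump r g') := by
  induction h with
  | nil g => exact .nil _
  | @accept a z z' g g' _ ha ih =>
    rw [← raise_bump ha]
    exact ih.accept (by simp only [Catabolism.bump]; split_ifs <;> omega)
  | reject _ ha ih => exact ih.reject ha

theorem PassesRel.bump {K : ℕ} {z : List ℕ} {g g' : ℕ → ℕ} (h : PassesRel Free K z g g') (r : ℕ) :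
    PassesRel Free K z (bump r g) (bump r g') := by
  induction h with
  | zero z g => exact .zero z _
  | succ h _ ih => exact .succ (h.bump r) ih

/-- `x` arises from `y` by moving a label to the right, past a smaller one, or `x = y`. -/
def Raised (x y : List ℕ) : Prop :=
  x = y ∨ ∃ p q a b, b < a ∧ x = p ++ b :: a :: q ∧ y = p ++ a :: b :: q

theorem Raised.cons {x y : List ℕ} (h : Raised x y) (c : ℕ) : Raised (c :: x) (c :: y) := by
  rcases h with rfl | ⟨p, q, a, b, hab, rfl, rfl⟩
  · exact .inl rfl
  · exact .inr ⟨c :: p, q, a, b, hab, rfl, rfl⟩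

theorem raise_apply_of_lt {a b : ℕ} (h : b < a) (g : ℕ → ℕ) : raise a g b = g b := by
  simp only [raise]
  split_ifs <;> omega

/-- The decisions on `a` and `b` are copied in the other order. Accepting `b` first takes no token
from row `a`, and accepting `a` takes or adds none in row `b`, because `b < a`. If one of the
letters is accepted the words become equal; if both are rejected, the inversion persists one label
higher. -/
theorem PassRel.raised {x y x' : List ℕ} {g g' : ℕ → ℕ} (h : PassRel Free x g x' g')
    (hxy : Raised x y) : ∃ y', PassRel Free y g y' g' ∧ Raised x' y' := by
  rcases hxy with rfl | ⟨p, q, a, b, hab, rfl, rfl⟩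
  · exact ⟨x', h, .inl rfl⟩
  induction p generalizing x' g' with
  | nil =>
    have hraise : ∀ {g : ℕ → ℕ}, 0 < g a → 0 < raise a g b →
        0 < g b ∧ 0 < raise b g a ∧ raise b (raise a g) = raise a (raise b g) := by
      intro g ha hb
      rw [raise_apply_of_lt hab] at hb
      refine ⟨hb, ?_, ?_⟩
      · simp only [raise]; split_ifs <;> omega
      · funext j
        have e1 : j = a → g j = g a := fun h => by rw [h]
        have e2 : j = b → g j = g b := fun h => by rw [h]
        simp only [raise]
        split_ifs <;> omega
    have hpos : ∀ {g : ℕ → ℕ}, 0 < raise a g b → 0 < g b := by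
      intro g hb; rwa [raise_apply_of_lt hab] at hb
    rw [List.nil_append] at h ⊢
    cases h with
    | accept h hb =>
      cases h with
      | accept h ha =>
        obtain ⟨h1, h2, h3⟩ := hraise ha hb
        rw [h3]
        exact ⟨_, (h.accept h1).accept h2, .inl rfl⟩
      | reject h _ => exact ⟨_, (h.accept hb).reject trivial, .inl rfl⟩
    | reject h _ =>
      cases h with
      | accept h ha => exact ⟨_, (h.reject trivial).accept ha, .inl rfl⟩
      | @reject _ _ z' _ _ h _ =>
        exact ⟨_, (h.reject trivial).reject trivial, .inr ⟨[], z', a + 1, b + 1, by omega, rfl, rfl⟩⟩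
  | cons c p ih =>
    cases h with
    | accept h hc =>
      obtain ⟨y', h1, h2⟩ := ih h
      exact ⟨y', h1.accept hc, h2⟩
    | reject h _ =>
      obtain ⟨y', h1, h2⟩ := ih h
      exact ⟨_, h1.reject trivial, h2.cons _⟩

theorem PassesRel.raised {K : ℕ} {x y : List ℕ} {g g' : ℕ → ℕ} (h : PassesRel Free K x g g')
    (hxy : Raised x y) : PassesRel Free K y g g' := by
  induction h generalizing y with
  | zero z g => exact .zero y g
  | succ h _ ih =>
    obtain ⟨y', h1, h2⟩ := h.raised hxy
    exact .succ h1 (ih h2)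

/-! ### Optimality of the greedy run -/

/-- One step of a run: the letter `l` is read, and `l'` is what it will be one period later. -/
def RunStep (l l' : Option ℕ) (g g' : ℕ → ℕ) : Prop :=
  (l = none ∧ l' = none ∧ g' = g) ∨
  (∃ a, l = some a ∧ l' = some (a + 1) ∧ g' = g) ∨
  (∃ a, l = some a ∧ l' = none ∧ 0 < g a ∧ g' = raise a g)

/-- A run with period `n`: `lab t` is the letter read at time `t`, and `g t` the state. -/
def IsRun (n : ℕ) (lab : ℕ → Option ℕ) (g : ℕ → ℕ → ℕ) : Prop :=
  ∀ t, RunStep (lab t) (lab (t + n)) (g t) (g (t + 1))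

/-- The number of accepted and waiting letters of row `k` at time `t`. -/
def rowLoad (n M : ℕ) (lab : ℕ → Option ℕ) (g : ℕ → ℕ → ℕ) (k t : ℕ) : ℤ :=
  ((M : ℤ) - ∑ j ∈ Finset.range (k + 1), (g t j : ℤ)) +
    ∑ s ∈ Finset.range n, if lab (t + s) = some k then 1 else 0

theorem sum_raise {a : ℕ} {g : ℕ → ℕ} (h : 0 < g a) (k : ℕ) :
    ∑ j ∈ Finset.range (k + 1), (raise a g j : ℤ) =
      ∑ j ∈ Finset.range (k + 1), (g j : ℤ) - if a = k then 1 else 0 := by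
  induction k with
  | zero =>
    rcases a with _ | a
    · simp only [zero_add, Finset.sum_range_one, raise, if_true]
      omega
    · simp [raise]
  | succ k ih =>
    rw [Finset.sum_range_succ, ih, Finset.sum_range_succ _ (k + 1)]
    simp only [raise]
    split_ifs <;> first | omega | (subst_vars; omega)

theorem sum_window (f : ℕ → ℤ) (n t : ℕ) :
    ∑ s ∈ Finset.range n, f (t + 1 + s) = ∑ s ∈ Finset.range n, f (t + s) - f t + f (t + n) := by
  have h1 := Finset.sum_range_succ (fun s => f (t + s)) n
  rw [Finset.sum_range_succ'] at h1
  simp only [add_zero, ← add_assoc, add_right_comm t _ 1] at h1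
  linarith

section

variable {n M : ℕ} {lab lab' : ℕ → Option ℕ} {g g' : ℕ → ℕ → ℕ}

theorem IsRun.rowLoad_of_reject (h : IsRun n lab g) {t a : ℕ} (ha : lab t = some a)
    (ha' : lab (t + n) = some (a + 1)) (k : ℕ) :
    rowLoad n M lab g k (t + 1) =
      rowLoad n M lab g k t - (if a = k then 1 else 0) + if a + 1 = k then 1 else 0 := by
  have hg : g (t + 1) = g t := by
    rcases h t with h | ⟨_, _, _, h⟩ | ⟨_, _, h, _⟩
    · exact h.2.2
    · exact h
    · simp [ha'] at h
  simp only [rowLoad, hg]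
  rw [sum_window (fun s => if lab s = some k then 1 else 0)]
  simp only [ha, ha', Option.some.injEq]
  ring

theorem IsRun.rowLoad_of_none (h : IsRun n lab g) {t : ℕ} (ht : lab (t + n) = none) (k : ℕ) :
    rowLoad n M lab g k (t + 1) = rowLoad n M lab g k t := by
  simp only [rowLoad]
  rw [sum_window (fun s => if lab s = some k then 1 else 0)]
  rcases h t with ⟨h1, _, h3⟩ | ⟨_, _, h, _⟩ | ⟨a, h1, _, h2, h3⟩
  · simp [h1, ht, h3]
  · simp [ht] at h
  · simp only [h1, ht, h3, sum_raise h2, Option.some.injEq, reduceCtorEq, if_false]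
    ring

/-- During one period each letter waiting in row `k` is accepted there or comes to wait in row `k +
1`. The letters accepted in row `k` number those accepted in row `k + 1` plus the tokens lying in
row `k + 1`. -/
theorem IsRun.rowLoad_add_period (h : IsRun n lab g) (k t : ℕ) :
    rowLoad n M lab g (k + 1) (t + n) + g (t + n) (k + 1) = rowLoad n M lab g k t := by
  have key : ∀ m, ((M : ℤ) - ∑ j ∈ Finset.range (k + 1), (g (t + m) j : ℤ)) +
      (∑ s ∈ Finset.range m, if lab (t + n + s) = some (k + 1) then (1 : ℤ) else 0) =
      ((M : ℤ) - ∑ j ∈ Finset.range (k + 1), (g t j : ℤ)) +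
      ∑ s ∈ Finset.range m, if lab (t + s) = some k then (1 : ℤ) else 0 := by
    intro m
    induction m with
    | zero => simp
    | succ m ih =>
      rw [Finset.sum_range_succ _ m, Finset.sum_range_succ _ m, ← add_assoc t m 1,
        add_right_comm t n m]
      rcases h (t + m) with ⟨h1, h2, h3⟩ | ⟨a, h1, h2, h3⟩ | ⟨a, h1, h2, h3, h4⟩
      · simp only [h1, h2, h3, reduceCtorEq, if_false]
        linarith
      · simp only [h1, h2, h3, Option.some.injEq, add_left_inj]
        linarith
      · simp only [h1, h2, h4, sum_raise h3, Option.some.injEq, reduceCtorEq, if_false]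
        linarith
  have := key n
  simp only [rowLoad]
  rw [← this, Finset.sum_range_succ]
  ring

/-- Adding the tokens of the row removes the dependence on the decision: the change is determined by
the letter read. -/
theorem IsRun.rowLoad_add_token (h : IsRun n lab g) (k t : ℕ) :
    rowLoad n M lab g k (t + 1) + g (t + 1) k = rowLoad n M lab g k t + g t k +
      ((if lab t = some k then -1 else 0) + if (lab t).map (· + 1) = some k then 1 else 0) := by
  rcases h t with ⟨h1, h2, h3⟩ | ⟨a, h1, h2, h3⟩ | ⟨a, h1, h2, h3, h4⟩
  · simp [h.rowLoad_of_none h2, h1, h3]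
  · rw [h.rowLoad_of_reject h1 h2, h1, h3]
    simp only [Option.some.injEq, Option.map_some]
    split_ifs <;> omega
  · rw [h.rowLoad_of_none h2, h1, h4]
    simp only [Option.some.injEq, Option.map_some, raise]
    split_ifs <;> first | omega | (subst_vars; omega)

theorem IsRun.rowLoad_add_token_eq (h : IsRun n lab g) (h' : IsRun n lab' g')
    (hlab : ∀ t < n, lab t = lab' t) (hg : g 0 = g' 0) {t : ℕ} (ht : t ≤ n) (k : ℕ) :
    rowLoad n M lab g k t + g t k = rowLoad n M lab' g' k t + g' t k := by
  induction t with
  | zero =>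
    simp only [rowLoad, hg, zero_add]
    congr 2
    refine Finset.sum_congr rfl fun s hs => ?_
    rw [hlab s (Finset.mem_range.1 hs)]
  | succ t ih =>
    rw [h.rowLoad_add_token, h'.rowLoad_add_token, ih (by omega), hlab t (by omega)]

/-- A greedy rejection means an empty row, so load plus tokens may be compared instead. In the first
period these agree for both runs; later they equal the load of the previous row one period earlier,
just after the same letter was rejected there, and induction applies. -/
theorem IsRun.rowLoad_le_of_reject (h : IsRun n lab g) (h' : IsRun n lab' g')
    (hlab : ∀ t < n, lab t = lab' t) (hg : g 0 = g' 0)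
    (hgreedy : ∀ t a, lab t = some a → lab (t + n) = some (a + 1) → g t a = 0) (hn : 0 < n)
    {t a : ℕ} (ha : lab t = some a) (ha' : lab (t + n) = some (a + 1)) :
    rowLoad n M lab' g' a (t + 1) ≤ rowLoad n M lab g a (t + 1) := by
  induction t using Nat.strong_induction_on generalizing a with
  | _ t ih =>
    have h0 : g (t + 1) a = 0 := by
      rw [← hgreedy t a ha ha']
      rcases h t with h | ⟨_, _, _, h⟩ | ⟨_, _, h, _⟩
      · rw [h.2.2]
      · rw [h]
      · simp [ha'] at h
    suffices H : rowLoad n M lab' g' a (t + 1) + g' (t + 1) a ≤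
        rowLoad n M lab g a (t + 1) + g (t + 1) a by
      rw [h0] at H
      push_cast at H
      linarith [Int.natCast_nonneg (g' (t + 1) a)]
    rcases Nat.lt_or_ge t n with ht | ht
    · exact (h.rowLoad_add_token_eq h' hlab hg ht a).ge
    · obtain ⟨t, rfl⟩ := Nat.exists_eq_add_of_le' ht
      rcases h t with ⟨_, h2, _⟩ | ⟨b, h1, h2, _⟩ | ⟨_, _, h2, _⟩
      · simp [h2] at ha
      · rw [ha, Option.some.injEq] at h2
        subst h2
        rw [add_right_comm t n 1, h.rowLoad_add_period, h'.rowLoad_add_period]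
        exact ih t (by omega) h1 ha
      · simp [h2] at ha

theorem IsRun.sum_rowLoad_of_reject (h : IsRun n lab g) {t a : ℕ} (ha : lab t = some a)
    (ha' : lab (t + n) = some (a + 1)) (k : ℕ) :
    ∑ i ∈ Finset.range k, rowLoad n M lab g i (t + 1) =
      ∑ i ∈ Finset.range k, rowLoad n M lab g i t - if a + 1 = k then 1 else 0 := by
  induction k with
  | zero => simp
  | succ k ih =>
    rw [Finset.sum_range_succ, Finset.sum_range_succ, ih, h.rowLoad_of_reject ha ha']
    split_ifs <;> omega

theorem IsRun.sum_rowLoad_of_none (h : IsRun n lab g) {t : ℕ} (ht : lab (t + n) = none) (k : ℕ) :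
    ∑ i ∈ Finset.range k, rowLoad n M lab g i (t + 1) =
      ∑ i ∈ Finset.range k, rowLoad n M lab g i t :=
  Finset.sum_congr rfl fun i _ => h.rowLoad_of_none ht i

theorem IsRun.sum_rowLoad_succ_le (h : IsRun n lab g) (k t : ℕ) :
    ∑ i ∈ Finset.range k, rowLoad n M lab g i (t + 1) ≤
      ∑ i ∈ Finset.range k, rowLoad n M lab g i t := by
  rcases h t with ⟨_, h2, _⟩ | ⟨a, h1, h2, _⟩ | ⟨a, _, h2, _⟩
  · exact (h.sum_rowLoad_of_none h2 k).le
  · rw [h.sum_rowLoad_of_reject h1 h2]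
    split_ifs <;> omega
  · exact (h.sum_rowLoad_of_none h2 k).le

/-- The load of the first `k` rows never grows, and the greedy one drops only when a letter `k - 1`
is rejected. At that moment row `k - 1` is compared by `IsRun.rowLoad_le_of_reject` and the rows
above it by induction. -/
theorem IsRun.sum_rowLoad_le (h : IsRun n lab g) (h' : IsRun n lab' g')
    (hlab : ∀ t < n, lab t = lab' t) (hg : g 0 = g' 0)
    (hgreedy : ∀ t a, lab t = some a → lab (t + n) = some (a + 1) → g t a = 0) (hn : 0 < n)
    (k t : ℕ) :
    ∑ i ∈ Finset.range k, rowLoad n M lab' g' i t ≤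
      ∑ i ∈ Finset.range k, rowLoad n M lab g i t := by
  induction t generalizing k with
  | zero =>
    refine Finset.sum_le_sum fun i _ => ?_
    have := h.rowLoad_add_token_eq (M := M) h' hlab hg (Nat.zero_le n) i
    rw [hg] at this
    linarith
  | succ t ih =>
    have h1 := (h'.sum_rowLoad_succ_le (M := M) k t).trans (ih k)
    rcases h t with ⟨_, h2, _⟩ | ⟨a, ha, h2, _⟩ | ⟨a, _, h2, _⟩
    · rwa [h.sum_rowLoad_of_none h2]
    · rcases eq_or_ne (a + 1) k with rfl | hk
      · rw [Finset.sum_range_succ, Finset.sum_range_succ]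
        refine add_le_add ?_ (h.rowLoad_le_of_reject h' hlab hg hgreedy hn ha h2)
        rw [h.sum_rowLoad_of_reject ha h2 a, if_neg (by omega), sub_zero]
        exact (h'.sum_rowLoad_succ_le (M := M) a t).trans (ih a)
      · rwa [h.sum_rowLoad_of_reject ha h2 k, if_neg hk, sub_zero]
    · rwa [h.sum_rowLoad_of_none h2]

theorem IsRun.le_label (h : IsRun n lab g) (K : ℕ) {t b : ℕ} (hb : lab (t + K * n) = some b) :
    K ≤ b := by
  induction K generalizing b with
  | zero => exact Nat.zero_le b
  | succ K ih =>
    rw [add_mul, one_mul, ← add_assoc] at hb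
    rcases h (t + K * n) with ⟨_, h2, _⟩ | ⟨a, h1, h2, _⟩ | ⟨_, _, h2, _⟩
    · simp [h2] at hb
    · rw [hb, Option.some.injEq] at h2
      have := ih h1
      omega
    · simp [h2] at hb

/-- After `k` periods nothing waits in the first `k` rows, so their load consists of accepted
letters. -/
theorem IsRun.sum_rowLoad_eq (h : IsRun n lab g) (k : ℕ) :
    ∑ i ∈ Finset.range k, rowLoad n M lab g i (k * n) = acceptedSum k M (g (k * n)) := by
  refine Finset.sum_congr rfl fun i hi => ?_
  rw [rowLoad, add_eq_left]
  refine Finset.sum_eq_zero fun s _ => if_neg fun hs => ?_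
  rw [add_comm] at hs
  have := h.le_label k hs
  have := Finset.mem_range.1 hi
  omega

end

/-! ### From passes to runs -/

/-- A word with gaps, read from the front as a queue, and the state. -/
abbrev QueueState := List (Option ℕ) × (ℕ → ℕ)

/-- Read the first entry of the queue; what remains of it is put at the end. -/
inductive QueueStep (P : (ℕ → ℕ) → ℕ → Prop) : QueueState → QueueState → Prop
  | gap (q : List (Option ℕ)) (g : ℕ → ℕ) : QueueStep P (none :: q, g) (q ++ [none], g)
  | accept {a : ℕ} (q : List (Option ℕ)) {g : ℕ → ℕ} (h : 0 < g a) :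
      QueueStep P (some a :: q, g) (q ++ [none], raise a g)
  | reject {a : ℕ} (q : List (Option ℕ)) {g : ℕ → ℕ} (h : P g a) :
      QueueStep P (some a :: q, g) (q ++ [some (a + 1)], g)

/-- Several steps. -/
inductive QueueSteps (P : (ℕ → ℕ) → ℕ → Prop) : ℕ → QueueState → QueueState → Prop
  | refl (s : QueueState) : QueueSteps P 0 s s
  | cons {T : ℕ} {s s' s'' : QueueState} :
      QueueStep P s s' → QueueSteps P T s' s'' → QueueSteps P (T + 1) s s''

theorem QueueSteps.trans {P : (ℕ → ℕ) → ℕ → Prop} {T T' : ℕ} {s s' s'' : QueueState}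
    (h : QueueSteps P T s s') (h' : QueueSteps P T' s' s'') : QueueSteps P (T + T') s s'' := by
  induction h with
  | refl => simpa using h'
  | cons h1 _ ih =>
    rw [Nat.add_right_comm]
    exact .cons h1 (ih h')

/-- Accepted letters leave gaps, so the queue keeps its length and each surviving letter returns
after exactly one period. -/
theorem PassRel.queueSteps {P : (ℕ → ℕ) → ℕ → Prop} {z z' : List ℕ} {g g' : ℕ → ℕ}
    (h : PassRel P z g z' g') (x : List (Option ℕ)) (hx : x.reduceOption = z) :
    ∃ x' : List (Option ℕ), x'.reduceOption = z' ∧ x'.length = x.length ∧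
      ∀ q, QueueSteps P x.length (x.reverse ++ q, g) (q ++ x'.reverse, g') := by
  induction x generalizing z z' g' with
  | nil =>
    rw [List.reduceOption_nil] at hx
    subst hx
    cases h
    exact ⟨[], rfl, rfl, fun q => by simpa using QueueSteps.refl _⟩
  | cons o x ih =>
    have main : ∀ {w : List ℕ} {k k' : ℕ → ℕ} (o' : Option ℕ), PassRel P x.reduceOption g w k →
        (∀ q, QueueStep P (o :: q, k) (q ++ [o'], k')) →
        ∃ x' : List (Option ℕ), x'.reduceOption = (o' :: [] : List (Option ℕ)).reduceOption ++ w ∧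
          x'.length = (o :: x).length ∧ ∀ q, QueueSteps P (o :: x).length
            ((o :: x).reverse ++ q, g) (q ++ x'.reverse, k') := by
      intro w k k' o' hw hstep
      obtain ⟨x', h1, h2, h3⟩ := ih hw rfl
      refine ⟨o' :: x', ?_, by simp [h2], fun q => ?_⟩
      · cases o' <;> simp [h1]
      · have h4 := (h3 (o :: q)).trans (.cons (hstep (q ++ x'.reverse)) (.refl _))
        simpa using h4
    cases o with
    | none =>
      rw [List.reduceOption_cons_of_none] at hx
      subst hx
      simpa using main none h fun q => .gap q _
    | some a =>
      rw [List.reduceOption_cons_of_some] at hx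
      subst hx
      cases h with
      | accept h ha => simpa using main none h fun q => .accept q ha
      | reject h ha => simpa using main (some (a + 1)) h fun q => .reject q ha

theorem PassesRel.queueSteps {P : (ℕ → ℕ) → ℕ → Prop} {K : ℕ} {z : List ℕ} {g g' : ℕ → ℕ}
    (h : PassesRel P K z g g') (x : List (Option ℕ)) (hx : x.reduceOption = z) :
    ∃ q, QueueSteps P (K * x.length) (x.reverse, g) (q, g') := by
  induction h generalizing x with
  | zero z g => exact ⟨x.reverse, by simpa using .refl _⟩
  | succ h1 _ ih =>
    obtain ⟨x', h2, h3, h4⟩ := h1.queueSteps x hx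
    obtain ⟨q, h5⟩ := ih x' h2
    rw [h3] at h5
    refine ⟨q, ?_⟩
    rw [add_mul, one_mul, add_comm]
    exact (by simpa using h4 [] : QueueSteps P x.length _ _).trans h5

theorem QueueStep.length_eq {P : (ℕ → ℕ) → ℕ → Prop} {s s' : QueueState} (h : QueueStep P s s') :
    s'.1.length = s.1.length := by
  cases h <;> simp

theorem exists_queueStep {P : (ℕ → ℕ) → ℕ → Prop} (hP : ∀ g a, g a = 0 → P g a) (s : QueueState)
    (hs : s.1 ≠ []) : ∃ s', QueueStep P s s' := by
  obtain ⟨_ | ⟨_ | a, q⟩, g⟩ := s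
  · exact absurd rfl hs
  · exact ⟨_, .gap q g⟩
  · rcases Nat.eq_zero_or_pos (g a) with h | h
    · exact ⟨_, .reject q (hP g a h)⟩
    · exact ⟨_, .accept q h⟩

theorem QueueStep.ne_nil {P : (ℕ → ℕ) → ℕ → Prop} {s s' : QueueState} (h : QueueStep P s s') :
    s'.1 ≠ [] := by
  cases h <;> simp

/-- `IsRun` concerns all times; a finite run is prolonged arbitrarily, some step being always
possible. -/
theorem QueueSteps.exists_seq {P : (ℕ → ℕ) → ℕ → Prop} (hP : ∀ g a, g a = 0 → P g a) {T : ℕ}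
    {s s' : QueueState} (h : QueueSteps P T s s') (hs : s.1 ≠ []) :
    ∃ st : ℕ → QueueState, st 0 = s ∧ st T = s' ∧ ∀ t, QueueStep P (st t) (st (t + 1)) := by
  induction h with
  | refl s =>
    choose f hf using fun s : {s : QueueState // s.1 ≠ []} => exists_queueStep hP s.1 s.2
    let st : ℕ → {s : QueueState // s.1 ≠ []} :=
      fun t => Nat.rec ⟨s, hs⟩ (fun _ r => ⟨f r, (hf r).ne_nil⟩) t
    exact ⟨fun t => (st t).1, rfl, rfl, fun t => hf (st t)⟩
  | @cons T s s1 s2 h1 _ ih =>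
    obtain ⟨st, h2, h3, h4⟩ := ih h1.ne_nil
    refine ⟨fun t => Nat.casesOn t s st, rfl, h3, fun t => ?_⟩
    cases t with
    | zero => simpa [h2] using h1
    | succ t => exact h4 t

theorem exists_run {P : (ℕ → ℕ) → ℕ → Prop} {st : ℕ → QueueState}
    (h : ∀ t, QueueStep P (st t) (st (t + 1))) :
    ∃ lab : ℕ → Option ℕ, IsRun (st 0).1.length lab (fun t => (st t).2) ∧
      (∀ t < (st 0).1.length, (st 0).1[t]? = some (lab t)) ∧
      ∀ t a, lab t = some a → lab (t + (st 0).1.length) = some (a + 1) → P (st t).2 a := by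
  have hlen : ∀ t, (st t).1.length = (st 0).1.length := by
    intro t
    induction t with
    | zero => rfl
    | succ t ih => rw [(h t).length_eq, ih]
  have hcons : ∀ t, ∃ o q o', (st t).1 = o :: q ∧ (st (t + 1)).1 = q ++ [o'] ∧
      RunStep o o' (st t).2 (st (t + 1)).2 ∧
      ∀ a, o = some a → o' = some (a + 1) → P (st t).2 a := by
    intro t
    have := h t
    generalize st t = s at this
    generalize st (t + 1) = s' at this
    cases this with
    | gap q g => exact ⟨none, q, none, rfl, rfl, .inl ⟨rfl, rfl, rfl⟩, by simp⟩
    | @accept a q g ha =>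
      exact ⟨some a, q, none, rfl, rfl, .inr (.inr ⟨a, rfl, rfl, ha, rfl⟩), by simp⟩
    | @reject a q g ha =>
      refine ⟨some a, q, _, rfl, rfl, .inr (.inl ⟨a, rfl, rfl, rfl⟩), fun b hb _ => ?_⟩
      rw [Option.some.injEq] at hb
      exact hb ▸ ha
  choose lab q lab' h1 h2 h3 h4 using hcons
  have hget : ∀ i t, i < (st 0).1.length → (st t).1[i]? = some (lab (t + i)) := by
    intro i
    induction i with
    | zero => intro t _; simp [h1 t]
    | succ i ih =>
      intro t hi
      have := ih (t + 1) (by omega)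
      have hl := hlen t
      rw [h1 t, List.length_cons] at hl
      rw [h2 t, List.getElem?_append_left (by omega)] at this
      rw [h1 t, List.getElem?_cons_succ, this]
      congr 2
      omega
  have hlab : ∀ t, lab' t = lab (t + (st 0).1.length) := by
    intro t
    have hl := hlen t
    rw [h1 t, List.length_cons] at hl
    have := hget (q t).length (t + 1) (by omega)
    rw [h2 t, List.getElem?_concat_length, Option.some.injEq] at this
    rw [this]
    congr 1
    omega
  refine ⟨lab, fun t => ?_, fun t ht => by simpa using hget t 0 ht, fun t a => ?_⟩
  · rw [← hlab]; exact h3 t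
  · rw [← hlab]; exact h4 t a

theorem PassesRel.exists_run {P : (ℕ → ℕ) → ℕ → Prop} (hP : ∀ g a, g a = 0 → P g a) {K : ℕ}
    {z : List ℕ} {g g' : ℕ → ℕ} (h : PassesRel P K z g g') (hz : z ≠ []) :
    ∃ (lab : ℕ → Option ℕ) (γ : ℕ → ℕ → ℕ), IsRun z.length lab γ ∧
      (∀ t < z.length, (z.map some).reverse[t]? = some (lab t)) ∧ γ 0 = g ∧
      γ (K * z.length) = g' ∧
      ∀ t a, lab t = some a → lab (t + z.length) = some (a + 1) → P (γ t) a := by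
  obtain ⟨q, hq⟩ := h.queueSteps (z.map some) (by simp [List.reduceOption])
  obtain ⟨st, h1, h2, h3⟩ := hq.exists_seq hP (by simpa using hz)
  obtain ⟨lab, h4, h5, h6⟩ := Catabolism.exists_run h3
  simp only [h1, List.length_reverse, List.length_map] at h4 h5 h6 h2
  exact ⟨lab, fun t => (st t).2, h4, h5, by simp [h1], by simp [h2], h6⟩

theorem PassesRel.acceptedSum_le {k M : ℕ} {z : List ℕ} {g' : ℕ → ℕ}
    (h : PassesRel Free k z (tokens M) g') : acceptedSum k M g' ≤ accepted k M z := by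
  -- A run needs a positive period, so the empty word is treated apart.
  rcases eq_or_ne z [] with rfl | hz
  · suffices H : ∀ {K : ℕ} {z : List ℕ} {g g' : ℕ → ℕ}, PassesRel Free K z g g' → z = [] →
        g' = (passes K z g).2 by
      rw [accepted, ← H h rfl]
    intro K z g g' h
    induction h with
    | zero => intro _; rfl
    | succ h1 _ ih =>
      rintro rfl
      cases h1
      exact ih rfl
  obtain ⟨lab', γ', h1', h2', h3', h4', -⟩ := h.exists_run (fun _ _ _ => trivial) hz
  obtain ⟨lab, γ, h1, h2, h3, h4, h5⟩ :=
    (passesRel_passes (P := Greedy) (fun _ _ h => h) k z (tokens M)).exists_run (fun _ _ h => h) hz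
  have := h1.sum_rowLoad_le (M := M) h1' (fun t ht => by
    have := (h2 t ht).symm.trans (h2' t ht)
    simpa using this) (h3.trans h3'.symm) h5 (List.length_pos_iff.2 hz) k (k * z.length)
  rwa [h1.sum_rowLoad_eq, h1'.sum_rowLoad_eq, h4, h4'] at this

theorem acceptedSum_bump (k m r : ℕ) (g : ℕ → ℕ) :
    acceptedSum k (m + r) (bump r g) = acceptedSum k m g := by
  refine Finset.sum_congr rfl fun i _ => ?_
  rw [Finset.sum_range_succ', Finset.sum_range_succ']
  simp only [bump, Nat.succ_ne_zero, if_false, if_true]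
  push_cast
  ring

/-- The greedy run with `m` tokens, with idle tokens added in row 0, is a legal run with `M` tokens,
hence not better than the greedy one. -/
theorem accepted_mono_cap {m M : ℕ} (h : m ≤ M) (k : ℕ) (z : List ℕ) :
    accepted k m z ≤ accepted k M z := by
  obtain ⟨r, rfl⟩ := Nat.exists_eq_add_of_le h
  have := (passesRel_passes (P := Free) (fun _ _ _ => trivial) k z (tokens m)).bump r
  rw [bump_tokens] at this
  have := this.acceptedSum_le
  rwa [acceptedSum_bump] at this

theorem Raised.accepted_le {x y : List ℕ} (h : Raised x y) (k M : ℕ) :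
    accepted k M x ≤ accepted k M y :=
  ((passesRel_passes (P := Free) (fun _ _ _ => trivial) k x (tokens M)).raised h).acceptedSum_le

/-! ### Knuth equivalence and row insertion -/

/-- The elementary Knuth transformations of words with distinct letters. -/
inductive KnuthMove : List ℕ → List ℕ → Prop
  | left {x y z : ℕ} (hxy : x < y) (hyz : y < z) : KnuthMove [y, x, z] [y, z, x]
  | right {x y z : ℕ} (hxy : x < y) (hyz : y < z) : KnuthMove [x, z, y] [z, x, y]

/-- Knuth equivalence. -/
inductive KnuthEquiv : List ℕ → List ℕ → Prop
  | refl (w : List ℕ) : KnuthEquiv w w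
  | symm {w w' : List ℕ} : KnuthEquiv w w' → KnuthEquiv w' w
  | trans {w w' w'' : List ℕ} : KnuthEquiv w w' → KnuthEquiv w' w'' → KnuthEquiv w w''
  | move (p q : List ℕ) {m m' : List ℕ} : KnuthMove m m' → KnuthEquiv (p ++ m ++ q) (p ++ m' ++ q)

theorem KnuthEquiv.append {w w' : List ℕ} (h : KnuthEquiv w w') (p q : List ℕ) :
    KnuthEquiv (p ++ w ++ q) (p ++ w' ++ q) := by
  induction h with
  | refl w => exact .refl _
  | symm _ ih => exact ih.symm
  | trans _ _ ih ih' => exact ih.trans ih'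
  | move p' q' hm => simpa using KnuthEquiv.move (p ++ p') (q' ++ q) hm

theorem KnuthEquiv.cons {w w' : List ℕ} (h : KnuthEquiv w w') (a : ℕ) :
    KnuthEquiv (a :: w) (a :: w') := by
  simpa using h.append [a] []

theorem KnuthMove.perm {m m' : List ℕ} (h : KnuthMove m m') : m.Perm m' := by
  cases h with
  | left => exact (List.Perm.swap _ _ _).cons _
  | right => exact List.Perm.swap _ _ _

theorem KnuthEquiv.perm {w w' : List ℕ} (h : KnuthEquiv w w') : w.Perm w' := by
  induction h with
  | refl w => exact .refl _
  | symm _ ih => exact ih.symm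
  | trans _ _ ih ih' => exact ih.trans ih'
  | move p q hm => exact (hm.perm.append_left p).append_right q

/-- First half of a bump: the new letter moves left until it stands behind the bumped entry `c`. The
left neighbour of each exchanged pair is the Knuth witness. -/
theorem knuthEquiv_move_left {c x : ℕ} {r : List ℕ} (hx : x < c)
    (hr : (c :: r).Pairwise (· < ·)) : KnuthEquiv (c :: (r ++ [x])) (c :: x :: r) := by
  induction r generalizing c with
  | nil => exact .refl _
  | cons d r ih =>
    rw [List.pairwise_cons] at hr
    have hcd := hr.1 d (by simp)
    refine ((ih (hx.trans hcd) hr.2).cons c).trans ?_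
    exact (KnuthEquiv.move [] r (.left hx hcd)).symm

/-- Second half of a bump: the bumped `y` moves to the front of the row, the right neighbour being
the Knuth witness. -/
theorem knuthEquiv_move_right {x y : ℕ} {r : List ℕ} (hx : x < y)
    (hr : (r ++ [x]).Pairwise (· < ·)) : KnuthEquiv (r ++ [y, x]) (y :: (r ++ [x])) := by
  induction r with
  | nil => exact .refl _
  | cons c r ih =>
    rw [List.cons_append, List.pairwise_cons] at hr
    refine ((ih hr.2).cons c).trans ?_
    cases r with
    | nil => exact KnuthEquiv.move [] [] (.right (hr.1 x (by simp)) hx)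
    | cons d r =>
      refine KnuthEquiv.move [] (r ++ [x]) (.right (hr.1 d (by simp)) ?_)
      have := hr.2
      rw [List.cons_append, List.pairwise_cons] at this
      exact (this.1 x (by simp)).trans hx

theorem insertRow_spec (x : ℕ) (r : List ℕ) :
    (insertRow x r = (r ++ [x], none) ∧ ∀ a ∈ r, a ≤ x) ∨
    ∃ r₁ y r₂, r = r₁ ++ y :: r₂ ∧ insertRow x r = (r₁ ++ x :: r₂, some y) ∧ x < y ∧
      ∀ a ∈ r₁, a ≤ x := by
  induction r with
  | nil => exact .inl ⟨rfl, by simp⟩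
  | cons b r ih =>
    simp only [insertRow]
    split_ifs with hb
    · exact .inr ⟨[], b, r, rfl, rfl, hb, by simp⟩
    · rcases ih with ⟨h1, h2⟩ | ⟨r₁, y, r₂, h1, h2, h3, h4⟩
      · refine .inl ⟨by simp [h1], ?_⟩
        simpa using ⟨by omega, h2⟩
      · refine .inr ⟨b :: r₁, y, r₂, by simp [h1], by simp [h2], h3, ?_⟩
        simpa using ⟨by omega, h4⟩

theorem rowWord_cons (r : List ℕ) (T : List (List ℕ)) : rowWord (r :: T) = rowWord T ++ r := by
  simp [rowWord]

theorem rowWord_eq (T : List (List ℕ)) : rowWord T = rowWord T.tail ++ firstRow T := by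
  cases T with
  | nil => rfl
  | cons r T => exact rowWord_cons r T

/-- Inserting a new letter into a tableau with increasing rows. -/
theorem insertTableau_spec {T : List (List ℕ)} {x : ℕ} (hT : ∀ r ∈ T, r.Pairwise (· < ·))
    (hx : (rowWord T ++ [x]).Nodup) :
    (∀ r ∈ insertTableau x T, r.Pairwise (· < ·)) ∧
      KnuthEquiv (rowWord T ++ [x]) (rowWord (insertTableau x T)) := by
  induction T generalizing x with
  | nil => exact ⟨by simp [insertTableau], .refl _⟩
  | cons r T ih =>
    have hr := hT r (by simp)
    have hT' : ∀ r ∈ T, r.Pairwise (· < ·) := fun s hs => hT s (by simp [hs])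
    have hxr : ∀ a ∈ r, a ≠ x := by
      rintro a ha rfl
      rw [rowWord_cons, List.nodup_append] at hx
      exact hx.2.2 a (by simp [ha]) a (by simp) rfl
    rcases insertRow_spec x r with ⟨h1, h2⟩ | ⟨r₁, y, r₂, rfl, h2, h3, h4⟩
    · simp only [insertTableau, h1, rowWord_cons, List.append_assoc]
      refine ⟨?_, .refl _⟩
      simp only [List.mem_cons, forall_eq_or_imp]
      refine ⟨?_, hT'⟩
      rw [List.pairwise_append]
      refine ⟨hr, by simp, fun a ha b hb => ?_⟩
      rw [List.mem_singleton.1 hb]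
      exact lt_of_le_of_ne (h2 a ha) (hxr a ha)
    · have hy : (rowWord T ++ [y]).Nodup := by
        refine hx.sublist ?_
        rw [rowWord_cons, List.append_assoc]
        refine (List.Sublist.refl _).append ?_
        simp
      obtain ⟨ih1, ih2⟩ := ih hT' hy
      have hlt : ∀ a ∈ r₁, a < x := fun a ha => lt_of_le_of_ne (h4 a ha) (hxr a (by simp [ha]))
      rw [List.pairwise_append, List.pairwise_cons] at hr
      simp only [insertTableau, h2]
      constructor
      · simp only [List.mem_cons, forall_eq_or_imp]
        refine ⟨?_, ih1⟩
        rw [List.pairwise_append, List.pairwise_cons]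
        refine ⟨hr.1, ⟨fun b hb => h3.trans (hr.2.1.1 b hb), hr.2.1.2⟩, fun a ha b hb => ?_⟩
        rcases List.mem_cons.1 hb with rfl | hb
        · exact hlt a ha
        · exact hr.2.2 a ha b (by simp [hb])
      · rw [rowWord_cons, rowWord_cons]
        have e1 := (knuthEquiv_move_left h3 (List.pairwise_cons.2 hr.2.1)).append (rowWord T ++ r₁) []
        have e2 := (knuthEquiv_move_right (r := r₁) h3 (by
          rw [List.pairwise_append]
          exact ⟨hr.1, by simp, fun a ha b hb => by
            rw [List.mem_singleton.1 hb]; exact hlt a ha⟩)).append (rowWord T) r₂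
        have e3 := ih2.append [] (r₁ ++ x :: r₂)
        simp only [List.append_assoc, List.append_nil, List.nil_append, List.cons_append]
          at e1 e2 e3 ⊢
        exact e1.trans (e2.trans e3)

theorem mem_rowWord_insertTableau {T : List (List ℕ)} {x e : ℕ}
    (he : e ∈ rowWord (insertTableau x T)) : e ∈ rowWord T ∨ e = x := by
  induction T generalizing x with
  | nil => simpa [insertTableau, rowWord] using he
  | cons r T ih =>
    rcases insertRow_spec x r with ⟨h1, -⟩ | ⟨r₁, y, r₂, rfl, h2, -⟩
    · simp only [insertTableau, h1, rowWord_cons, List.mem_append, List.mem_singleton] at he ⊢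
      tauto
    · simp only [insertTableau, h2, rowWord_cons, List.mem_append, List.mem_cons] at he ⊢
      rcases he with he | he
      · rcases ih he with h | h <;> tauto
      · tauto

/-- Every entry below the first row is larger than some entry of the first row. -/
theorem insertTableau_exists_lt {T : List (List ℕ)} (x : ℕ)
    (h : ∀ e ∈ rowWord T.tail, ∃ f ∈ firstRow T, f < e) :
    ∀ e ∈ rowWord (insertTableau x T).tail, ∃ f ∈ firstRow (insertTableau x T), f < e := by
  cases T with
  | nil => simp [insertTableau, rowWord]
  | cons r T =>
    simp only [firstRow, List.tail_cons, List.headD_cons] at h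
    rcases insertRow_spec x r with ⟨h1, -⟩ | ⟨r₁, y, r₂, rfl, h2, h3, -⟩
    · simp only [insertTableau, h1, firstRow, List.tail_cons, List.headD_cons]
      intro e he
      obtain ⟨f, hf, hfe⟩ := h e he
      exact ⟨f, by simp [hf], hfe⟩
    · simp only [insertTableau, h2, firstRow, List.tail_cons, List.headD_cons]
      intro e he
      rcases mem_rowWord_insertTableau he with he | rfl
      · obtain ⟨f, hf, hfe⟩ := h e he
        simp only [List.mem_append, List.mem_cons] at hf
        rcases hf with hf | rfl | hf
        · exact ⟨f, by simp [hf], hfe⟩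
        · exact ⟨x, by simp, h3.trans hfe⟩
        · exact ⟨f, by simp [hf], hfe⟩
      · exact ⟨x, by simp, h3⟩

theorem insertionTableau_concat (w : List ℕ) (x : ℕ) :
    insertionTableau (w ++ [x]) = insertTableau x (insertionTableau w) := by
  simp [insertionTableau]

theorem insertionTableau_spec {w : List ℕ} (hw : w.Nodup) :
    (∀ r ∈ insertionTableau w, r.Pairwise (· < ·)) ∧
      KnuthEquiv w (rowWord (insertionTableau w)) ∧
      ∀ e ∈ rowWord (insertionTableau w).tail, ∃ f ∈ firstRow (insertionTableau w), f < e := by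
  induction w using List.reverseRecOn with
  | nil => exact ⟨by simp [insertionTableau], .refl _, by simp [insertionTableau, rowWord]⟩
  | append_singleton w x ih =>
    obtain ⟨h1, h2, h⟩ := ih (hw.sublist (List.sublist_append_left _ _))
    have h3 := h2.append [] [x]
    simp only [List.nil_append] at h3
    obtain ⟨h4, h5⟩ := insertTableau_spec h1 (h3.perm.nodup_iff.1 hw)
    rw [insertionTableau_concat]
    exact ⟨h4, h3.trans h5, insertTableau_exists_lt x h⟩

theorem pairwise_firstRow {w : List ℕ} (hw : w.Nodup) :
    (firstRow (insertionTableau w)).Pairwise (· < ·) := by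
  have := (insertionTableau_spec hw).1
  cases h : insertionTableau w with
  | nil => simp [firstRow]
  | cons r T => exact this r (by simp [h])

/-! ### Labeled words -/

/-- The condition on the letters `a`, `b` of a word, `a` being to the left of `b`: the labels
increase weakly with the letters, and strictly if the larger letter is to the left. -/
def LabelRel (ℓ : ℕ → ℕ) (a b : ℕ) : Prop := (a < b ∧ ℓ a ≤ ℓ b) ∨ (b < a ∧ ℓ b < ℓ a)

/-- `ℓ` has the properties of the cocharge labels of the letters of `w`. -/
structure IsLabeled (ℓ : ℕ → ℕ) (w : List ℕ) : Prop where
  pairwise : w.Pairwise (LabelRel ℓ)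
  descent : ∀ L, L + 1 ∈ w.map ℓ → ¬ (w.map ℓ).Pairwise fun s t => s = L + 1 → t ≠ L

/-! ### Knuth moves of letters as label moves -/

theorem LabelEquiv.perm {z z' : List ℕ} (h : LabelEquiv z z') : z.Perm z' := by
  induction h with
  | refl z => exact .refl _
  | symm _ ih => exact ih.symm
  | trans _ _ ih ih' => exact ih.trans ih'
  | move p q hm =>
    refine List.Perm.append_right _ (List.Perm.append_left _ ?_)
    cases hm with
    | far => exact List.Perm.swap _ _ _
    | high => exact (List.Perm.swap _ _ _).cons _
    | low => exact List.Perm.swap _ _ _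

theorem pairwise_append_congr {α : Type*} {R : α → α → Prop} {m m' : List α} (hm : m.Perm m')
    (h : m.Pairwise R ↔ m'.Pairwise R) (p q : List α) :
    (p ++ m ++ q).Pairwise R ↔ (p ++ m' ++ q).Pairwise R := by
  simp only [List.pairwise_append, h, List.mem_append, hm.mem_iff]

/-- Only `high` and `low` exchange neighbouring labels, and in both the third letter keeps some `a +
1` to the left of an `a`. Thus `IsLabeled.descent`, the minimality of the labels, survives. -/
theorem LabelEquiv.pairwise_iff {z z' : List ℕ} (h : LabelEquiv z z') (L : ℕ) :
    (z.Pairwise fun s t => s = L + 1 → t ≠ L) ↔ z'.Pairwise fun s t => s = L + 1 → t ≠ L := by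
  induction h with
  | refl z => exact .rfl
  | symm _ ih => exact ih.symm
  | trans _ _ ih ih' => exact ih.trans ih'
  | move p q hm =>
    refine pairwise_append_congr (by simpa using hm.equiv.perm) ?_ p q
    cases hm <;>
      simp only [List.pairwise_cons, List.mem_cons, List.not_mem_nil, or_false, forall_eq_or_imp,
        forall_eq, IsEmpty.forall_iff, implies_true, List.Pairwise.nil, and_true] <;> omega

theorem KnuthMove.pairwise_iff {ℓ : ℕ → ℕ} {m m' : List ℕ} (h : KnuthMove m m') :
    m.Pairwise (LabelRel ℓ) ↔ m'.Pairwise (LabelRel ℓ) := by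
  cases h <;>
    simp only [List.pairwise_cons, List.mem_cons, List.not_mem_nil, or_false, forall_eq_or_imp,
      forall_eq, IsEmpty.forall_iff, implies_true, List.Pairwise.nil, and_true, LabelRel] <;> omega

/-- The relative order of the letters forces the labels of `x` and `z` to differ. If they differ by
at least 2 they commute; otherwise the label of `y` is forced and the move is `high` or `low`. -/
theorem KnuthMove.labelEquiv {ℓ : ℕ → ℕ} {m m' : List ℕ} (h : KnuthMove m m')
    (hm : m.Pairwise (LabelRel ℓ)) : LabelEquiv (m.map ℓ) (m'.map ℓ) := by
  cases h with
  | @left x y z hxy hyz =>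
    have h1 : ℓ x < ℓ y ∧ ℓ y ≤ ℓ z := by
      simp only [List.pairwise_cons, List.mem_cons, List.not_mem_nil, or_false, forall_eq_or_imp,
        forall_eq, LabelRel] at hm
      omega
    simp only [List.map_cons, List.map_nil]
    rcases Nat.lt_or_ge (ℓ z) (ℓ x + 2) with h2 | h2
    · rw [show ℓ y = ℓ x + 1 by omega, show ℓ z = ℓ x + 1 by omega]
      exact (LabelMove.high _).equiv.symm
    · exact LabelEquiv.move [ℓ y] [] (.far h2)
  | @right x y z hxy hyz =>
    have h1 : ℓ x ≤ ℓ y ∧ ℓ y < ℓ z := by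
      simp only [List.pairwise_cons, List.mem_cons, List.not_mem_nil, or_false, forall_eq_or_imp,
        forall_eq, LabelRel] at hm
      omega
    simp only [List.map_cons, List.map_nil]
    rcases Nat.lt_or_ge (ℓ z) (ℓ x + 2) with h2 | h2
    · rw [show ℓ y = ℓ x by omega, show ℓ z = ℓ x + 1 by omega]
      exact (LabelMove.low _).equiv
    · exact LabelEquiv.move [] [ℓ y] (.far h2)

theorem KnuthEquiv.pairwise_iff {ℓ : ℕ → ℕ} {w w' : List ℕ} (h : KnuthEquiv w w') :
    w.Pairwise (LabelRel ℓ) ↔ w'.Pairwise (LabelRel ℓ) := by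
  induction h with
  | refl w => exact .rfl
  | symm _ ih => exact ih.symm
  | trans _ _ ih ih' => exact ih.trans ih'
  | move p q hm => exact pairwise_append_congr hm.perm hm.pairwise_iff p q

theorem KnuthEquiv.labelEquiv {ℓ : ℕ → ℕ} {w w' : List ℕ} (h : KnuthEquiv w w')
    (hw : w.Pairwise (LabelRel ℓ)) : LabelEquiv (w.map ℓ) (w'.map ℓ) := by
  induction h with
  | refl w => exact .refl _
  | symm h ih => exact (ih (h.pairwise_iff.2 hw)).symm
  | trans h _ ih ih' => exact (ih hw).trans (ih' (h.pairwise_iff.1 hw))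
  | move p q hm =>
    rw [List.pairwise_append, List.pairwise_append] at hw
    simpa using (hm.labelEquiv hw.1.2.1).append (p.map ℓ) (q.map ℓ)

theorem IsLabeled.of_knuthEquiv {ℓ : ℕ → ℕ} {w w' : List ℕ} (hw : IsLabeled ℓ w)
    (h : KnuthEquiv w w') : IsLabeled ℓ w' := by
  have e := h.labelEquiv hw.pairwise
  refine ⟨h.pairwise_iff.1 hw.pairwise, fun L hL => ?_⟩
  rw [← e.pairwise_iff]
  exact hw.descent L (e.perm.mem_iff.2 hL)

theorem IsLabeled.nodup {ℓ : ℕ → ℕ} {w : List ℕ} (hw : IsLabeled ℓ w) : w.Nodup :=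
  hw.pairwise.imp fun h => by rcases h with h | h <;> omega

theorem IsLabeled.zero_mem {ℓ : ℕ → ℕ} {w : List ℕ} (hw : IsLabeled ℓ w) (h : w ≠ []) :
    0 ∈ w.map ℓ := by
  obtain ⟨a, ha⟩ := List.exists_mem_of_ne_nil w h
  suffices H : ∀ L, L ∈ w.map ℓ → 0 ∈ w.map ℓ from H (ℓ a) (List.mem_map_of_mem ha)
  intro L
  induction L with
  | zero => exact id
  | succ L ih =>
    intro hL
    by_contra h0
    exact hw.descent L hL (List.pairwise_of_forall_mem_list fun s _ t ht _ h =>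
      h0 (ih (h ▸ ht)))

/-- The labels of the word obtained by a catabolism. -/
def catLabel (x : List ℕ) (ℓ : ℕ → ℕ) (j : ℕ) : ℕ := if j ∈ x then ℓ j else ℓ j - 1

section

variable {ℓ : ℕ → ℕ} {y a x : List ℕ}

theorem IsLabeled.notMem_of_mem (h : IsLabeled ℓ (y ++ (a ++ x))) {j : ℕ} (hj : j ∈ y) :
    j ∉ x := fun hx => by
  have := (List.nodup_append.1 h.nodup).2.2 j hj j (by simp [hx])
  exact this rfl

theorem IsLabeled.map_catLabel (h : IsLabeled ℓ (y ++ (a ++ x))) :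
    (x ++ y).map (catLabel x ℓ) = x.map ℓ ++ y.map fun j => ℓ j - 1 := by
  rw [List.map_append]
  congr 1
  · exact List.map_congr_left fun j hj => by simp [catLabel, hj]
  · exact List.map_congr_left fun j hj => by simp [catLabel, h.notMem_of_mem hj]

/-- Moving `x` from the right of `y` to its left turns weak inequalities between their labels into
strict ones and conversely; lowering the labels on `y` by one compensates exactly. -/
theorem IsLabeled.catabolism (h : IsLabeled ℓ (y ++ (a ++ x))) (ha : ∀ j ∈ a, ℓ j = 0)
    (hy : ∀ j ∈ y, 0 < ℓ j) : IsLabeled (catLabel x ℓ) (x ++ y) := by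
  have hp := h.pairwise
  simp only [List.pairwise_append, List.mem_append] at hp
  have hd := h.descent
  simp only [List.map_append, List.pairwise_append, List.mem_append, List.mem_map,
    List.pairwise_map] at hd
  have hcx : ∀ j ∈ x, catLabel x ℓ j = ℓ j := fun j hj => by simp [catLabel, hj]
  have hcy : ∀ j ∈ y, catLabel x ℓ j = ℓ j - 1 := fun j hj => by
    simp [catLabel, h.notMem_of_mem hj]
  constructor
  · rw [List.pairwise_append]
    refine ⟨hp.2.1.2.1.imp_of_mem fun {i j} hi hj hij => ?_,
      hp.1.imp_of_mem fun {i j} hi hj hij => ?_, fun i hi j hj => ?_⟩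
    · rwa [LabelRel, hcx i hi, hcx j hj]
    · have := hy i hi
      have := hy j hj
      rw [LabelRel] at hij
      rw [LabelRel, hcy i hi, hcy j hj]
      omega
    · have hij := hp.2.2 j hj i (.inr hi)
      have := hy j hj
      rw [LabelRel] at hij
      rw [LabelRel, hcx i hi, hcy j hj]
      omega
  · rw [h.map_catLabel]
    intro L hL hpw
    simp only [List.pairwise_append, List.pairwise_map, List.mem_map] at hpw
    obtain ⟨hx', hy', hxy⟩ := hpw
    -- A label `L + 1` in `x` bars the old label `L + 1` from `y`, so the old descent from `L + 1`
    -- to `L` would lie inside `x`.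
    have case1 : ∀ j ∈ x, ℓ j ≠ L + 1 := by
      intro j hj hjL
      have hyL : ∀ i ∈ y, ℓ i ≠ L + 1 := fun i hi hiL =>
        hxy _ ⟨j, hj, rfl⟩ _ ⟨i, hi, rfl⟩ hjL (by omega)
      refine hd L (.inr (.inr ⟨j, hj, hjL⟩)) ⟨?_, ⟨?_, hx', ?_⟩, ?_⟩
      · exact List.pairwise_of_forall_mem_list fun i hi _ _ h => absurd h (hyL i hi)
      · exact List.pairwise_of_forall_mem_list fun i hi _ _ h => by
          rw [ha i hi] at h; omega
      · rintro _ ⟨i, hi, rfl⟩ _ _ h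
        rw [ha i hi] at h; omega
      · rintro _ ⟨i, hi, rfl⟩ _ _ h
        exact absurd h (hyL i hi)
    rcases List.mem_append.1 hL with hL | hL
    · obtain ⟨j, hj, hjL⟩ := List.mem_map.1 hL
      exact case1 j hj hjL
    · obtain ⟨j, hj, hjL⟩ := List.mem_map.1 hL
      -- The old label is `L + 2`. Its old descent to `L + 1` lies inside `y`, since by `case1`
      -- nothing in `x` has label `L + 1`.
      refine hd (L + 1) (.inl ⟨j, hj, by omega⟩) ⟨?_, ⟨?_, ?_, ?_⟩, ?_⟩
      · exact hy'.imp fun h h1 h2 => h (by omega) (by omega)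
      · exact List.pairwise_of_forall_mem_list fun i hi _ _ h => by
          rw [ha i hi] at h; omega
      · exact List.pairwise_of_forall_mem_list fun _ _ i hi _ => case1 i hi
      · rintro _ ⟨i, hi, rfl⟩ _ _ h
        rw [ha i hi] at h; omega
      · rintro _ ⟨i, hi, rfl⟩ _ (⟨k, hk, rfl⟩ | ⟨k, hk, rfl⟩) _
        · rw [ha k hk]; omega
        · exact case1 k hk

theorem IsLabeled.accepted_catabolism (h : IsLabeled ℓ (y ++ (a ++ x)))
    (ha : ∀ j ∈ a, ℓ j = 0) (hy : ∀ j ∈ y, 0 < ℓ j) (hx : x.Pairwise (· < ·)) (k : ℕ) :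
    accepted (k + 1) a.length ((y ++ (a ++ x)).map ℓ) =
      a.length + accepted k a.length ((x ++ y).map (catLabel x ℓ)) := by
  have e1 : y.map ℓ = (y.map fun j => ℓ j - 1).map (· + 1) := by
    rw [List.map_map]
    exact List.map_congr_left fun j hj => (Nat.sub_add_cancel (hy j hj)).symm
  have e2 : a.map ℓ = List.replicate a.length 0 := by
    rw [List.eq_replicate_iff]
    simpa using ha
  rw [h.map_catLabel, List.map_append, List.map_append, e1, e2, ← List.append_assoc]
  refine accepted_succ k _ (List.pairwise_map.2 ?_)
  have hp := h.pairwise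
  simp only [List.pairwise_append] at hp
  refine hp.2.1.2.1.imp₂ (fun i j h1 h2 => ?_) hx
  rcases h1 with h1 | h1 <;> omega

end

/-! ### Catabolizability of the insertion tableau -/

section

variable {ℓ : ℕ → ℕ} {w : List ℕ}

theorem IsLabeled.rowWord (h : IsLabeled ℓ w) (m : ℕ) :
    IsLabeled ℓ (rowWord (insertionTableau w).tail ++
      ((firstRow (insertionTableau w)).take m ++ (firstRow (insertionTableau w)).drop m)) := by
  rw [List.take_append_drop, ← rowWord_eq]
  exact h.of_knuthEquiv (insertionTableau_spec h.nodup).2.1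

theorem IsLabeled.accepted_rowWord (h : IsLabeled ℓ w) (k M m : ℕ) :
    accepted k M (w.map ℓ) = accepted k M ((Catabolism.rowWord (insertionTableau w).tail ++
      ((firstRow (insertionTableau w)).take m ++
        (firstRow (insertionTableau w)).drop m)).map ℓ) := by
  rw [List.take_append_drop, ← rowWord_eq]
  exact ((insertionTableau_spec h.nodup).2.1.labelEquiv h.pairwise).accepted_eq k M

/-- A smaller entry of the first row stands further right in the row word, so its label is strictly
smaller. -/
theorem IsLabeled.pos_of_mem_tail (h : IsLabeled ℓ w) :
    ∀ e ∈ Catabolism.rowWord (insertionTableau w).tail, 0 < ℓ e := by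
  intro e he
  obtain ⟨f, hf, hfe⟩ := (insertionTableau_spec h.nodup).2.2 e he
  have := (h.rowWord 0).pairwise
  rw [List.pairwise_append] at this
  rcases this.2.2 e he f (by simpa using hf) with h | h <;> omega

theorem accepted_zero (M : ℕ) (z : List ℕ) : accepted 0 M z = 0 := by
  simp [accepted, acceptedSum]

theorem accepted_nil (k M : ℕ) : accepted k M [] = 0 := by
  have h : ∀ K g, (passes K [] g).2 = g := by
    intro K g
    induction K with
    | zero => rfl
    | succ K ih => exact ih
  rw [accepted, h, acceptedSum]
  refine Finset.sum_eq_zero fun i _ => ?_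
  rw [Finset.sum_range_succ']
  simp [tokens]

/-- If `a` had a positive label, some letter with this label would precede a letter `c` with label
one less. All letters outside the initial block have at least the label of `a`, so `c` lies in the
block. Inside the increasing block labels do not descend, and the larger letters to its left have
labels above that of `a`. -/
theorem IsLabeled.eq_zero_of_take (h : IsLabeled ℓ w) {m : ℕ}
    (hm : ∀ a ∈ (firstRow (insertionTableau w)).take m,
      ∀ b ∈ (firstRow (insertionTableau w)).drop m ++ Catabolism.rowWord (insertionTableau w).tail,
        a < b) :
    ∀ a ∈ (firstRow (insertionTableau w)).take m, ℓ a = 0 := by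
  have hl := h.rowWord m
  have hs := (pairwise_firstRow h.nodup).sublist (List.take_sublist m _)
  generalize (firstRow (insertionTableau w)).take m = A at *
  generalize (firstRow (insertionTableau w)).drop m = X at *
  generalize Catabolism.rowWord (insertionTableau w).tail = Y at *
  intro a ha
  by_contra h0
  have hd := hl.descent (ℓ a - 1) (List.mem_map.2 ⟨a, by simp [ha], by omega⟩)
  have hp := hl.pairwise
  simp only [List.pairwise_append, List.mem_append] at hp
  simp only [List.mem_append] at hm
  have hlow : ∀ b, (b ∈ Y ∨ b ∈ X) → ℓ a ≤ ℓ b := by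
    intro b hb
    have hab := hm a ha b hb.symm
    rcases hb with hb | hb
    · rcases hp.2.2 b hb a (.inl ha) with h | h <;> omega
    · rcases hp.2.1.2.2 a ha b hb with h | h <;> omega
  refine hd ?_
  simp only [List.map_append, List.pairwise_append, List.mem_append, List.mem_map,
    List.pairwise_map]
  refine ⟨?_, ⟨?_, ?_, ?_⟩, ?_⟩
  · exact List.pairwise_of_forall_mem_list fun _ _ b hb _ => by have := hlow b (.inl hb); omega
  · refine hp.2.1.1.imp₂ (fun b c hbc hlt h1 h2 => ?_) hs
    rcases hbc with h | h <;> omega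
  · exact List.pairwise_of_forall_mem_list fun _ _ b hb _ => by have := hlow b (.inr hb); omega
  · rintro _ _ _ ⟨b, hb, rfl⟩ _
    have := hlow b (.inr hb); omega
  · rintro _ ⟨b, hb, rfl⟩ _ (⟨c, hc, rfl⟩ | ⟨c, hc, rfl⟩) h1
    · have hab := hm a ha b (.inr hb)
      rcases hp.2.2 b hb a (.inl ha) with h | h <;> omega
    · have := hlow c (.inr hc); omega

theorem insertionTableau_eq_nil (hw : w.Nodup) (h : insertionTableau w = []) : w = [] := by
  have := (insertionTableau_spec hw).2.1.perm
  rw [h] at this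
  simpa [Catabolism.rowWord] using this

/-- An upper bound for the partitions for which an insertion tableau is catabolizable. -/
theorem IsLabeled.sum_take_le {μ : List ℕ} (h : IsLabeled ℓ w) {M : ℕ}
    (hμ : μ.Pairwise (· ≥ ·)) (hM : ∀ m ∈ μ, m ≤ M)
    (hc : IsCatabolizable μ (insertionTableau w)) (k : ℕ) :
    ((μ.take k).sum : ℤ) ≤ accepted k M (w.map ℓ) := by
  induction μ generalizing w ℓ M k with
  | nil =>
    rw [insertionTableau_eq_nil h.nodup hc, List.map_nil, accepted_nil]
    simp
  | cons m μ ih =>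
    rw [List.pairwise_cons] at hμ
    obtain ⟨h1, h2, h3⟩ := hc
    cases k with
    | zero => simp [accepted_zero]
    | succ k =>
      have ha := h.eq_zero_of_take h2
      have hl := h.rowWord m
      have hlen : ((firstRow (insertionTableau w)).take m).length = m := by
        rw [List.length_take]; omega
      have hacc := hl.accepted_catabolism ha h.pos_of_mem_tail
        ((pairwise_firstRow h.nodup).sublist (List.drop_sublist m _)) k
      rw [hlen] at hacc
      -- The remaining parts are at most `m`, so the cap can be lowered from `M` to `m`.
      have hih := ih (hl.catabolism ha h.pos_of_mem_tail) hμ.2 hμ.1 h3 k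
      have hcap := accepted_mono_cap (hM m (by simp)) (k + 1) (w.map ℓ)
      rw [h.accepted_rowWord (k + 1) m m, hacc] at hcap
      rw [List.take_succ_cons, List.sum_cons]
      rw [Nat.cast_add]
      linarith

/-- Tokens of row 0 in excess of the number of zeros are never used. -/
theorem pass_bump {z : List ℕ} {g : ℕ → ℕ} (r : ℕ) (h : z.count 0 ≤ g 0) :
    pass z (bump r g) = ((pass z g).1, bump r (pass z g).2) ∧
      z.count 0 + (pass z g).2 0 = g 0 := by
  induction z with
  | nil => exact ⟨rfl, by simp [pass]⟩
  | cons a z ih =>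
    rw [List.count_cons] at h
    obtain ⟨h1, h2⟩ := ih (by omega)
    rw [List.count_cons]
    simp only [pass, h1]
    rcases Nat.eq_zero_or_pos a with rfl | ha
    · simp only [beq_self_eq_true, if_true] at h ⊢
      have h3 : 0 < (pass z g).2 0 := by omega
      have h4 : 0 < bump r (pass z g).2 0 := by simp only [bump, if_true]; omega
      simp only [h3, h4, if_true, raise_bump h3, true_and, raise]
      omega
    · have h3 : bump r (pass z g).2 a = (pass z g).2 a := by simp [bump, ha.ne']
      simp only [h3, beq_iff_eq, ha.ne', if_false]
      split_ifs with h4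
      · refine ⟨by rw [raise_bump h4], ?_⟩
        simp only [raise_apply_of_lt ha]
        omega
      · exact ⟨rfl, by omega⟩

theorem passes_bump {z : List ℕ} {g : ℕ → ℕ} (r : ℕ) (h : z.count 0 ≤ g 0) (K : ℕ) :
    (passes K z (bump r g)).2 = bump r (passes K z g).2 := by
  induction K generalizing z g with
  | zero => rfl
  | succ K ih =>
    simp only [passes, (pass_bump r h).1]
    refine ih ?_
    rw [List.count_eq_zero_of_not_mem]
    · exact Nat.zero_le _
    · intro h0
      have := le_of_mem_pass (r := 0) g (fun _ _ => Nat.zero_le _) 0 h0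
      omega

theorem accepted_min_count (k M : ℕ) (z : List ℕ) :
    accepted k (min M (z.count 0)) z = accepted k M z := by
  rcases le_total M (z.count 0) with h | h
  · rw [min_eq_left h]
  · rw [min_eq_right h]
    obtain ⟨r, rfl⟩ := Nat.exists_eq_add_of_le h
    rw [accepted, accepted, ← bump_tokens, passes_bump r (by simp [tokens]), acceptedSum_bump]

theorem take_eq_replicate_of_pairwise {s : List ℕ} (hs : s.Pairwise (· ≤ ·)) {m : ℕ}
    (hm : m ≤ s.count 0) : s.take m = List.replicate m 0 := by
  induction s generalizing m with
  | nil => simp at hm; simp [hm]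
  | cons a s ih =>
    rw [List.pairwise_cons] at hs
    cases m with
    | zero => rfl
    | succ m =>
      rcases Nat.eq_zero_or_pos a with rfl | ha
      · rw [List.count_cons_self] at hm
        rw [List.take_succ_cons, ih hs.2 (by omega), List.replicate_succ]
      · rw [List.count_eq_zero_of_not_mem] at hm
        · omega
        · simp only [List.mem_cons, not_or]
          exact ⟨ha.ne, fun h0 => by have := hs.1 0 h0; omega⟩

/-- The insertion tableau is catabolizable for the partition found by the procedure. -/
theorem IsLabeled.exists_isCatabolizable (h : IsLabeled ℓ w) {M : ℕ} (hM : 0 < M) :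
    ∃ μ : List ℕ, μ.Pairwise (· ≥ ·) ∧ (∀ m ∈ μ, 0 < m ∧ m ≤ M) ∧ μ.sum = w.length ∧
      IsCatabolizable μ (insertionTableau w) ∧
      ∀ k, ((μ.take k).sum : ℤ) = accepted k M (w.map ℓ) := by
  induction hn : w.length using Nat.strong_induction_on generalizing w ℓ M with
  | _ n ih =>
    subst hn
    rcases eq_or_ne w [] with rfl | hw
    · exact ⟨[], by simp, by simp, rfl, rfl, fun k => by simp [accepted_nil]⟩
    -- The largest block that can be cut off: bounded by the previous part `M` and by the number of
    -- zero labels. Recursion with cap `m` keeps the parts weakly decreasing.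
    set m := min M ((w.map ℓ).count 0) with hm
    have hmpos : 0 < m := lt_min hM (List.count_pos_iff.2 (h.zero_mem hw))
    have hl := h.rowWord m
    have hpos := h.pos_of_mem_tail
    have hp := hl.pairwise
    have hrow := pairwise_firstRow h.nodup
    have hperm := (insertionTableau_spec h.nodup).2.1.perm
    rw [rowWord_eq] at hperm
    have hsorted : ((firstRow (insertionTableau w)).map ℓ).Pairwise (· ≤ ·) := by
      rw [List.pairwise_map]
      rw [List.take_append_drop, List.pairwise_append] at hp
      refine hp.2.1.imp₂ (fun i j h1 h2 => ?_) hrow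
      rcases h1 with h1 | h1 <;> omega
    have hcount : m ≤ ((firstRow (insertionTableau w)).map ℓ).count 0 := by
      refine (min_le_right _ _).trans ?_
      rw [(hperm.map ℓ).count_eq, List.map_append, List.count_append,
        List.count_eq_zero_of_not_mem, zero_add]
      intro h0
      obtain ⟨e, he, he0⟩ := List.mem_map.1 h0
      exact (hpos e he).ne' he0
    have hmlen : m ≤ (firstRow (insertionTableau w)).length := by
      simpa using hcount.trans List.count_le_length
    have hlen : ((firstRow (insertionTableau w)).take m).length = m := by
      rw [List.length_take]; omega
    have ha : ∀ j ∈ (firstRow (insertionTableau w)).take m, ℓ j = 0 := by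
      intro j hj
      have := take_eq_replicate_of_pairwise hsorted hcount
      rw [← List.map_take] at this
      exact List.eq_of_mem_replicate (this ▸ List.mem_map_of_mem hj)
    have hacc := hl.accepted_catabolism ha hpos (hrow.sublist (List.drop_sublist m _))
    rw [hlen] at hacc
    have hlen2 : ((firstRow (insertionTableau w)).drop m ++
        Catabolism.rowWord (insertionTableau w).tail).length + m = w.length := by
      rw [hperm.length_eq, List.length_append, List.length_append, List.length_drop]
      omega
    obtain ⟨μ, h1, h2, h3, h4, h5⟩ := ih _ (by omega) (hl.catabolism ha hpos) hmpos rfl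
    refine ⟨m :: μ, ?_, ?_, ?_, ⟨hmlen, ?_, h4⟩, ?_⟩
    · exact List.pairwise_cons.2 ⟨fun a ha => (h2 a ha).2, h1⟩
    · simp only [List.mem_cons, forall_eq_or_imp]
      exact ⟨⟨hmpos, min_le_left _ _⟩, fun a ha =>
        ⟨(h2 a ha).1, (h2 a ha).2.trans (min_le_left _ _)⟩⟩
    · rw [List.sum_cons, h3]
      omega
    · intro a haA b hb
      rcases List.mem_append.1 hb with hb | hb
      · rw [← List.take_append_drop m (firstRow (insertionTableau w)),
          List.pairwise_append] at hrow
        exact hrow.2.2 a haA b hb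
      · rw [List.pairwise_append] at hp
        have := ha a haA
        have := hpos b hb
        rcases hp.2.2 b hb a (List.mem_append_left _ haA) with h | h <;> omega
    · intro k
      cases k with
      | zero => simp [accepted_zero]
      | succ k =>
        rw [← accepted_min_count, ← hm, h.accepted_rowWord (k + 1) m m, hacc, ← h5 k]
        simp

end

/-! ### Cocharge labels -/

theorem cochargeLabel_mono (w : List ℕ) : Monotone (cochargeLabel w) := by
  refine monotone_nat_of_le_succ fun i => ?_
  rcases i with _ | i
  · simp [cochargeLabel]
  · simp only [cochargeLabel]
    split_ifs <;> omega

/-- Labels are monotone, so equality at the ends excludes any increase, that is any step to the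
left, in between. -/
theorem idxOf_le_of_cochargeLabel_eq (w : List ℕ) {a b : ℕ} (ha : 0 < a) (hab : a ≤ b)
    (h : cochargeLabel w a = cochargeLabel w b) : w.idxOf a ≤ w.idxOf b := by
  induction b, hab using Nat.le_induction with
  | base => exact le_rfl
  | succ b hab ih =>
    have h1 := cochargeLabel_mono w hab
    have h2 := cochargeLabel_mono w (Nat.le_succ b)
    obtain ⟨b, rfl⟩ : ∃ c, b = c + 1 := ⟨b - 1, by omega⟩
    refine (ih (by simp only [Nat.succ_eq_add_one] at *; omega)).trans ?_
    by_contra hlt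
    have : cochargeLabel w (b + 1 + 1) = cochargeLabel w (b + 1) + 1 := by
      rw [cochargeLabel, if_pos (not_le.1 hlt)]
    simp only [Nat.succ_eq_add_one] at *
    omega

theorem exists_descent_of_cochargeLabel (w : List ℕ) {L j : ℕ} (hj : cochargeLabel w j = L + 1) :
    ∃ i, 0 < i ∧ i + 1 ≤ j ∧ cochargeLabel w (i + 1) = L + 1 ∧ cochargeLabel w i = L ∧
      w.idxOf (i + 1) < w.idxOf i := by
  induction j with
  | zero => simp [cochargeLabel] at hj
  | succ j ih =>
    rcases j with _ | j
    · simp [cochargeLabel] at hj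
    by_cases h : w.idxOf (j + 2) < w.idxOf (j + 1)
    · refine ⟨j + 1, by omega, le_rfl, hj, ?_, h⟩
      rw [cochargeLabel, if_pos h] at hj
      omega
    · have hj' := hj
      rw [cochargeLabel, if_neg h] at hj'
      obtain ⟨i, h1, h2, h3⟩ := ih hj'
      exact ⟨i, h1, by omega, h3⟩

theorem StandardWord.mem_letters {n : ℕ} (u : StandardWord n) {a : ℕ} :
    a ∈ u.letters ↔ 0 < a ∧ a ≤ n := by
  rw [u.perm.mem_iff, List.mem_range'_1]
  omega

theorem StandardWord.nodup {n : ℕ} (u : StandardWord n) : u.letters.Nodup :=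
  u.perm.nodup_iff.2 List.nodup_range'

theorem StandardWord.isLabeled {n : ℕ} (u : StandardWord n) :
    IsLabeled (cochargeLabel u.letters) u.letters := by
  constructor
  · rw [List.pairwise_iff_getElem]
    intro i j hi hj hij
    have hlt : u.letters.idxOf u.letters[i] < u.letters.idxOf u.letters[j] := by
      rwa [u.nodup.idxOf_getElem, u.nodup.idxOf_getElem]
    have ha := u.mem_letters.1 (List.getElem_mem hi)
    have hb := u.mem_letters.1 (List.getElem_mem hj)
    generalize u.letters[i] = a at *
    generalize u.letters[j] = b at *
    rcases lt_trichotomy a b with h | rfl | h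
    · exact .inl ⟨h, cochargeLabel_mono _ h.le⟩
    · exact absurd hlt (lt_irrefl _)
    · refine .inr ⟨h, lt_of_le_of_ne (cochargeLabel_mono _ h.le) fun e => ?_⟩
      have := idxOf_le_of_cochargeLabel_eq _ hb.1 h.le e
      omega
  · intro L hL hp
    obtain ⟨j, hj, hjL⟩ := List.mem_map.1 hL
    obtain ⟨i, h1, h2, h3, h4, h5⟩ := exists_descent_of_cochargeLabel _ hjL
    have hj' := u.mem_letters.1 hj
    have hi : i ∈ u.letters := u.mem_letters.2 ⟨h1, by omega⟩
    have hi' : i + 1 ∈ u.letters := u.mem_letters.2 ⟨by omega, by omega⟩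
    rw [List.pairwise_map, List.pairwise_iff_getElem] at hp
    have := hp _ _ (List.idxOf_lt_length_of_mem hi') (List.idxOf_lt_length_of_mem hi) h5
    simp only [List.getElem_idxOf] at this
    exact this h3 h4

/-! ### The catabolizability of a standard word -/

theorem le_of_mem_partsList {n : ℕ} (p : n.Partition) : ∀ m ∈ partsList p, m ≤ n := by
  intro m hm
  have hm' : m ∈ p.parts := by simpa [partsList] using hm
  exact (Multiset.single_le_sum (fun _ _ => Nat.zero_le _) m hm').trans_eq p.parts_sum

theorem pairwise_partsList {n : ℕ} (p : n.Partition) : (partsList p).Pairwise (· ≥ ·) :=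
  Multiset.pairwise_sort _ _

theorem StandardWord.sum_take_le {n : ℕ} (u : StandardWord n) (p : n.Partition)
    (hp : IsCatabolizable (partsList p) (insertionTableau u.letters)) (k : ℕ) :
    (((partsList p).take k).sum : ℤ) ≤ accepted k n (cochargeLabeling u.letters) :=
  u.isLabeled.sum_take_le (pairwise_partsList p) (le_of_mem_partsList p) hp k

theorem StandardWord.exists_partition {n : ℕ} (u : StandardWord n) :
    ∃ p : n.Partition, IsCatabolizable (partsList p) (insertionTableau u.letters) ∧
      ∀ k, (((partsList p).take k).sum : ℤ) = accepted k n (cochargeLabeling u.letters) := by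
  have hlen : u.letters.length = n := by rw [u.perm.length_eq, List.length_range']
  -- The construction of the partition needs a positive cap, so `n = 0` is separate.
  rcases Nat.eq_zero_or_pos n with rfl | hn
  · have hu : u.letters = [] := List.length_eq_zero_iff.1 hlen
    refine ⟨⟨0, by simp, rfl⟩, ?_, fun k => ?_⟩
    · simp [partsList, IsCatabolizable, hu, insertionTableau]
    · simp [partsList, hu, cochargeLabeling, accepted_nil]
  · obtain ⟨μ, h1, h2, h3, h4, h5⟩ := u.isLabeled.exists_isCatabolizable hn
    let p : n.Partition := ⟨μ, fun hi => (h2 _ hi).1, by rw [Multiset.sum_coe, h3, hlen]⟩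
    have hp : partsList p = μ := by
      simp only [partsList, p, Multiset.coe_sort]
      exact List.mergeSort_eq_self _ h1
    exact ⟨p, by rwa [hp], fun k => by rw [hp]; exact h5 k⟩

theorem StandardWord.isCatabolizability_ctype {n : ℕ} (u : StandardWord n) :
    IsCatabolizability (insertionTableau u.letters) (ctype u) := by
  obtain ⟨p, h1, h2⟩ := u.exists_partition
  refine Classical.epsilon_spec (p := fun p => IsCatabolizability (insertionTableau u.letters) p)
    ⟨p, h1, fun q hq k => ?_⟩
  have := u.sum_take_le q hq k
  rw [← h2 k] at this
  exact_mod_cast this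

theorem exists_swapAdjacent_eq {i : ℕ} {z : List ℕ} (hi : i + 1 < z.length) :
    ∃ p a b q, z = p ++ a :: b :: q ∧ swapAdjacent i z = p ++ b :: a :: q ∧
      z.getD i 0 = a ∧ z.getD (i + 1) 0 = b := by
  induction i generalizing z with
  | zero =>
    rcases z with _ | ⟨a, _ | ⟨b, q⟩⟩
    · simp at hi
    · simp at hi
    · exact ⟨[], a, b, q, rfl, rfl, rfl, rfl⟩
  | succ i ih =>
    rcases z with _ | ⟨c, z⟩
    · simp at hi
    · obtain ⟨p, a, b, q, h1, h2, h3, h4⟩ := ih (z := z) (by simpa using hi)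
      exact ⟨c :: p, a, b, q, by simp [h1], by simp [swapAdjacent, h2], by simpa using h3,
        by simpa using h4⟩

end Catabolism

theorem mainTheorem8 {n : ℕ} (u v : Catabolism.StandardWord n)
    (h : Catabolism.IsAscent u v) :
    Catabolism.IsCatabolizability (Catabolism.insertionTableau u.letters) (Catabolism.ctype u) ∧
    Catabolism.IsCatabolizability (Catabolism.insertionTableau v.letters) (Catabolism.ctype v) ∧
    Catabolism.Dominates (Catabolism.ctype u) (Catabolism.ctype v) := by
  have hu := u.isCatabolizability_ctype
  have hv := v.isCatabolizability_ctype
  refine ⟨hu, hv, fun k => ?_⟩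
  obtain ⟨i, hi, huv, hpres, hgt⟩ := h
  have hlen : (Catabolism.cochargeLabeling u.letters).length = n := by
    rw [Catabolism.cochargeLabeling, List.length_map, u.perm.length_eq, List.length_range']
  obtain ⟨p, a, b, q, h1, h2, h3, h4⟩ :=
    Catabolism.exists_swapAdjacent_eq (i := i) (hi.trans_eq hlen.symm)
  rw [h3, h4] at hgt
  rw [Catabolism.IsCochargePreserving, ← huv, h2] at hpres
  have hraised : Catabolism.Raised (Catabolism.cochargeLabeling v.letters)
      (Catabolism.cochargeLabeling u.letters) := .inr ⟨p, q, a, b, hgt, hpres, h1⟩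
  -- The partition `r` realizes the bound for `u`, and `ctype u` dominates it.
  obtain ⟨r, hr1, hr2⟩ := u.exists_partition
  have e1 := v.sum_take_le _ hv.1 k
  have e2 := hraised.accepted_le k n
  rw [← hr2 k] at e2
  exact (by exact_mod_cast e1.trans e2 : _ ≤ _).trans (hu.2 r hr1 k)
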